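/- Let $d,n\ge 0$ be integers, let $A_1,\dots,A_n:\mathbb R^d\rightrightarrows\mathbb R^d$ be maximal monotone, and let $B:\mathbb R^d\to\mathbb R^d$ be monotone and $L$-Lipschitz. Assume that the inclusion $$0\in\sum_{i=1}^n A_i(z)+B(z)\qquad(*)$$ has at least one solution. Stochastic Projective Splitting takes $\tau>0$, deterministic stepsizes $\alpha_k,\rho_k\ge 0$ and an initial point $p^1=(z^1,w_1^1,\dots,w_{n+1}^1)\in(\mathbb R^d)^{n+2}$ (possibly random) with $\sum_{i=1}^{n+1}w_i^1=0$, and for $k=1,2,\dots$ computes, with $J_{\tau A_i}=(I+\tau A_i)^{-1}$, $$t_i^k=z^k+\tau w_i^k,\quad x_i^k=J_{\tau A_i}(t_i^k),\quad y_i^k=\tau^{-1}(t_i^k-x_i^k)\qquad(i=1,\dots,n),$$ $$r^k=B(z^k)+\epsilon^k,\quad x_{n+1}^k=z^k-\rho_k(r^k-w_{n+1}^k),\quad y_{n+1}^k=B(x_{n+1}^k)+e^k,$$ $$z^{k+1}=z^k-\alpha_k\sum_{i=1}^{n+1}y_i^k,\qquad w_i^{k+1}=w_i^k-\alpha_k\Big(x_i^k-\frac1{n+1}\sum_{j=1}^{n+1}x_j^k\Big)\quad(i=1,\dots,n+1),$$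 where the noise terms $\epsilon^k,e^k$ are integrable $\mathbb R^d$-valued random variables on a probability space. Write $p^k=(z^k,w_1^k,\dots,w_{n+1}^k)$, $\mathcal F_k=\sigma(p^1,\dots,p^k)$ and $\mathcal E_k=\sigma(\epsilon^k)$, and suppose that there are constants $N_1,N_2,N_3,N_4\in[0,\infty)$ such that, for every $k$, almost surely, $$\mathbb E[\epsilon^k\mid\mathcal F_k]=0,\qquad \mathbb E[e^k\mid\mathcal F_k]=0,$$ $$\mathbb E[\|\epsilon^k\|^2\mid\mathcal F_k]\le N_1+N_2\|B(z^k)\|^2,\qquad \mathbb E[\|e^k\|^2\mid\mathcal F_k,\mathcal E_k]\le N_3+N_4\|B(x_{n+1}^k)\|^2.$$ Suppose moreover that $$\sum_k\alpha_k\rho_k=\infty,\qquad \sum_k\alpha_k^2<\infty,\qquad \sum_k\alpha_k\rho_k^2<\infty,\qquad \rho_k\le\overline\rho\ \text{ for all }k,\quad \overline\rho<\frac1L$$ (where $1/L=\infty$ if $L=0$). Then, with probability one, $z^k$ converges to a (random) solution $z^*$ of $(*)$; and, with probability one, $p^k$ converges to a (random) point of the extended solution set $$\mathcal S=\Big\{(z,w_1,\dots,w_{n+1})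 : w_i\in A_i(z)\ (i=1,\dots,n),\ w_{n+1}=B(z),\ \sum_{i=1}^{n+1}w_i=0\Big\}.$$ -/

import Mathlib

open MeasureTheory ProbabilityTheory Filter Topology
open scoped Pointwise ENNReal NNReal

namespace SPS

/-- The Euclidean space `ℝ^d`. -/
abbrev Vec (d : ℕ) : Type := EuclideanSpace ℝ (Fin d)

/-- A point-to-set map `A` on `ℝ^d` is a monotone operator. -/
def IsMonotoneOp {d : ℕ} (A : Vec d → Set (Vec d)) : Prop :=
  ∀ ⦃x y u v : Vec d⦄, u ∈ A x → v ∈ A y → 0 ≤ inner ℝ (u - v) (x - y)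

/-- A monotone operator is maximal if no other monotone operator has a graph containing its
graph. -/
def IsMaximalMonotone {d : ℕ} (A : Vec d → Set (Vec d)) : Prop :=
  IsMonotoneOp A ∧
    ∀ A' : Vec d → Set (Vec d), IsMonotoneOp A' → (∀ x, A x ⊆ A' x) → A' = A

/-- The value at `t` of the resolvent `(I + τ A)⁻¹`, as a set. For `A` maximal monotone and
`0 < τ` it is a single point. -/
def resolventOp {d : ℕ} (τ : ℝ) (A : Vec d → Set (Vec d)) (t : Vec d) : Set (Vec d) :=
  {x | t ∈ {x} + τ • A x}

/-- `z` solves the inclusion `0 ∈ ∑ i, A i z + B z`. -/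
def IsSolution {d n : ℕ} (A : Fin n → Vec d → Set (Vec d)) (B : Vec d → Vec d) (z : Vec d) :
    Prop :=
  (0 : Vec d) ∈ (∑ i, A i z) + {B z}

/-- The extended solution set. The dual vectors `w_1, …, w_n` are `w i.castSucc` for `i : Fin n`,
and `w_{n+1}` is `w (Fin.last n)`. -/
def extendedSolutionSet {d n : ℕ} (A : Fin n → Vec d → Set (Vec d)) (B : Vec d → Vec d) :
    Set (Vec d × (Fin (n + 1) → Vec d)) :=
  {p | (∀ i : Fin n, p.2 i.castSucc ∈ A i p.1) ∧ p.2 (Fin.last n) = B p.1 ∧ ∑ i, p.2 i = 0}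

/-- The sequences `z, w, x, y` are produced by stochastic projective splitting with resolvent
stepsize `τ`, stepsizes `α, ρ` and noise values `ε, e`. The first iteration has index `0`. -/
structure IsRun {d n : ℕ} (A : Fin n → Vec d → Set (Vec d)) (B : Vec d → Vec d) (τ : ℝ)
    (α ρ : ℕ → ℝ) (ε e : ℕ → Vec d) (z : ℕ → Vec d) (w x y : ℕ → Fin (n + 1) → Vec d) :
    Prop where
  sum_w_zero : ∑ i, w 0 i = 0
  x_resolvent : ∀ (k : ℕ) (i : Fin n),
    x k i.castSucc ∈ resolventOp τ (A i) (z k + τ • w k i.castSucc)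
  y_resolvent : ∀ (k : ℕ) (i : Fin n),
    y k i.castSucc = τ⁻¹ • ((z k + τ • w k i.castSucc) - x k i.castSucc)
  x_last : ∀ k, x k (Fin.last n) = z k - ρ k • ((B (z k) + ε k) - w k (Fin.last n))
  y_last : ∀ k, y k (Fin.last n) = B (x k (Fin.last n)) + e k
  z_succ : ∀ k, z (k + 1) = z k - α k • ∑ i, y k i
  w_succ : ∀ (k : ℕ) (i : Fin (n + 1)),
    w (k + 1) i = w k i - α k • (x k i - ((n : ℝ) + 1)⁻¹ • ∑ j, x k j)

/-- The σ-algebra generated by the primal-dual iterates up to index `k`. -/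
abbrev pastSigma {Ω : Type*} {d n : ℕ} (z : ℕ → Ω → Vec d) (w : ℕ → Ω → Fin (n + 1) → Vec d)
    (k : ℕ) : MeasurableSpace Ω :=
  ⨆ (j : ℕ) (_ : j ≤ k), MeasurableSpace.comap (fun ω => (z j ω, w j ω)) inferInstance

/-- The σ-algebra generated by the random vector `X`. -/
abbrev noiseSigma {Ω : Type*} {d : ℕ} (X : Ω → Vec d) : MeasurableSpace Ω :=
  MeasurableSpace.comap X inferInstance

end SPS

/-! Measure the squared Euclidean distance from `p^k` to a fixed point `q` of the extended solution
set. Its exact expansion (`IsRun.sqDist_succ`) decreases by `2 α_k` times the gap between the values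
at `p^k` and at `q` of an affine function built from the pairs `(x_i, y_i)`, up to an `α_k²` term.
Monotonicity and the Lipschitz bound make this gap at least `c ρ_k` times a residual, up to noise
(`IsRun.gap_lower_bound`). The noise enters linearly with coefficients known at time `k`, so these
terms average to zero, and quadratically with the summable weights `α_k ρ_k²` and `α_k²`.

The distance is therefore an almost supermartingale, and `robbins_siegmund` shows that almost surely
it converges and `∑ α_k ρ_k · residual` is finite. As `∑ α_k ρ_k = ∞`, the residual tends to zero
along a subsequence, and closedness of maximal monotone graphs puts a cluster point in the extended
solution set (`IsRun.exists_cluster_point`). An Opial-type argument, run with a countable dense set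
of points `q` so that a single null set suffices, upgrades this to convergence of the whole sequence
(`tendsto_of_tendsto_sqDist`). -/

namespace SPS

/-! ### Resolvents, maximal monotonicity and the primal-dual distance -/

theorem mem_resolventOp_iff {d : ℕ} {τ : ℝ} {A : Vec d → Set (Vec d)} {t x : Vec d} :
    x ∈ resolventOp τ A t ↔ ∃ u ∈ A x, t = x + τ • u := by
  simp only [resolventOp, Set.mem_ofPred_eq, Set.singleton_add, Set.mem_image, Set.mem_smul_set]
  constructor
  · rintro ⟨_, ⟨u, hu, rfl⟩, rfl⟩
    exact ⟨u, hu, rfl⟩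
  · rintro ⟨u, hu, rfl⟩
    exact ⟨_, ⟨u, hu, rfl⟩, rfl⟩

theorem inv_smul_sub_mem_of_mem_resolventOp {d : ℕ} {τ : ℝ} (hτ : 0 < τ)
    {A : Vec d → Set (Vec d)} {t x : Vec d} (h : x ∈ resolventOp τ A t) :
    τ⁻¹ • (t - x) ∈ A x := by
  obtain ⟨u, hu, rfl⟩ := mem_resolventOp_iff.1 h
  simpa [smul_smul, inv_mul_cancel₀ hτ.ne'] using hu

/-- Expanding the square on the right leaves the cross term `2τ⟨u - v, x - y⟩`, nonnegative by
monotonicity. This yields both nonexpansiveness of the resolvent and the growth bound on `(x_i,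
y_i)`. -/
theorem IsMonotoneOp.norm_sq_add_le {d : ℕ} {A : Vec d → Set (Vec d)} (hA : IsMonotoneOp A)
    {τ : ℝ} (hτ : 0 < τ) {x y u v : Vec d} (hu : u ∈ A x) (hv : v ∈ A y) :
    ‖x - y‖ ^ 2 + τ ^ 2 * ‖u - v‖ ^ 2 ≤ ‖(x + τ • u) - (y + τ • v)‖ ^ 2 := by
  have h := hA hu hv
  have e : (x + τ • u) - (y + τ • v) = (x - y) + τ • (u - v) := by
    rw [smul_sub]; abel
  rw [e, norm_add_sq_real, norm_smul, inner_smul_right, real_inner_comm, mul_pow,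
    Real.norm_eq_abs, sq_abs]
  nlinarith [mul_nonneg hτ.le h]

/-- The resolvent is single-valued and 1-Lipschitz where it is nonempty, and a Lipschitz map on a
subset of a finite-dimensional space extends to the whole space. Minty's theorem is thus avoided;
the continuous extension serves to make the iterates measurable. -/
theorem IsMonotoneOp.exists_continuous_resolvent {d : ℕ} {A : Vec d → Set (Vec d)}
    (hA : IsMonotoneOp A) {τ : ℝ} (hτ : 0 < τ) :
    ∃ J : Vec d → Vec d, Continuous J ∧ ∀ t x, x ∈ resolventOp τ A t → x = J t := by
  classical
  have key : ∀ t t' x x', x ∈ resolventOp τ A t → x' ∈ resolventOp τ A t' →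
      dist x x' ≤ dist t t' := by
    intro t t' x x' hx hx'
    obtain ⟨u, hu, rfl⟩ := mem_resolventOp_iff.1 hx
    obtain ⟨v, hv, rfl⟩ := mem_resolventOp_iff.1 hx'
    have := hA.norm_sq_add_le hτ hu hv
    rw [dist_eq_norm, dist_eq_norm]
    refine le_of_sq_le_sq ?_ (norm_nonneg _)
    nlinarith [mul_nonneg (sq_nonneg τ) (sq_nonneg ‖u - v‖)]
  let D : Set (Vec d) := {t | (resolventOp τ A t).Nonempty}
  let f : Vec d → Vec d := fun t => if h : (resolventOp τ A t).Nonempty then h.some else 0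
  have hf : ∀ t ∈ D, f t ∈ resolventOp τ A t := by
    intro t ht
    have ht' : (resolventOp τ A t).Nonempty := ht
    simp only [f, dif_pos ht']
    exact ht'.some_mem
  have hlip : LipschitzOnWith 1 f D := LipschitzOnWith.of_dist_le_mul fun s hs t ht => by
    simpa using key s t _ _ (hf s hs) (hf t ht)
  obtain ⟨J, hJ, hJeq⟩ := hlip.extend_finite_dimension
  refine ⟨J, hJ.continuous, fun t x hx => ?_⟩
  have htD : t ∈ D := ⟨x, hx⟩
  rw [← hJeq htD]
  have := key t t x (f t) hx (hf t htD)
  rw [dist_self] at this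
  exact dist_le_zero.1 this

/-- Adjoining `(y, v)` to the graph keeps it monotone, so maximality means it was already there. -/
theorem IsMaximalMonotone.mem_of_forall {d : ℕ} {A : Vec d → Set (Vec d)}
    (hA : IsMaximalMonotone A) {y v : Vec d}
    (h : ∀ x u, u ∈ A x → 0 ≤ inner ℝ (u - v) (x - y)) : v ∈ A y := by
  have hmono : IsMonotoneOp fun x => A x ∪ {u | x = y ∧ u = v} := by
    rintro x x' u u' (hu | ⟨rfl, rfl⟩) (hu' | ⟨rfl, rfl⟩)
    · exact hA.1 hu hu'
    · exact h _ _ hu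
    · have := h _ _ hu'
      rwa [← neg_sub u u', ← neg_sub x x', inner_neg_neg] at this
    · simp
  rw [← hA.2 _ hmono fun x => Set.subset_union_left]
  exact Or.inr ⟨rfl, rfl⟩

theorem IsMaximalMonotone.mem_of_tendsto {d : ℕ} {A : Vec d → Set (Vec d)}
    (hA : IsMaximalMonotone A) {x u : ℕ → Vec d} {y v : Vec d} (hu : ∀ k, u k ∈ A (x k))
    (hx : Tendsto x atTop (𝓝 y)) (huv : Tendsto u atTop (𝓝 v)) : v ∈ A y := by
  refine hA.mem_of_forall fun x' u' hu' => ?_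
  exact ge_of_tendsto' ((tendsto_const_nhds.sub huv).inner (tendsto_const_nhds.sub hx))
    fun k => hA.1 hu' (hu k)

theorem exists_mem_extendedSolutionSet {d n : ℕ} {A : Fin n → Vec d → Set (Vec d)}
    {B : Vec d → Vec d} {z : Vec d} (h : IsSolution A B z) :
    ∃ w, (z, w) ∈ extendedSolutionSet A B := by
  obtain ⟨s, hs, b, hb, h0⟩ := Set.mem_add.1 h
  rw [Set.mem_singleton_iff] at hb
  subst hb
  obtain ⟨g, hg, rfl⟩ := (Set.mem_fintype_sum _ _).1 hs
  refine ⟨Fin.snoc g (B z), ?_, ?_, ?_⟩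
  · intro i
    simpa using hg i
  · simp
  · simpa [Fin.sum_univ_castSucc] using h0

theorem isSolution_of_mem_extendedSolutionSet {d n : ℕ} {A : Fin n → Vec d → Set (Vec d)}
    {B : Vec d → Vec d} {p : Vec d × (Fin (n + 1) → Vec d)} (h : p ∈ extendedSolutionSet A B) :
    IsSolution A B p.1 := by
  obtain ⟨h1, h2, h3⟩ := h
  refine Set.mem_add.2 ⟨∑ i : Fin n, p.2 i.castSucc, ?_, B p.1, rfl, ?_⟩
  · exact (Set.mem_fintype_sum _ _).2 ⟨fun i => p.2 i.castSucc, h1, rfl⟩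
  · rw [← h3, Fin.sum_univ_castSucc, h2]

/-- The squared Euclidean distance on the primal-dual space. -/
noncomputable def sqDist {d m : ℕ} (p q : Vec d × (Fin m → Vec d)) : ℝ :=
  ‖p.1 - q.1‖ ^ 2 + ∑ i, ‖p.2 i - q.2 i‖ ^ 2

section sqDist

variable {d m : ℕ} (p q r : Vec d × (Fin m → Vec d))

theorem sqDist_nonneg : 0 ≤ sqDist p q := by unfold sqDist; positivity

theorem norm_fst_sub_sq_le_sqDist : ‖p.1 - q.1‖ ^ 2 ≤ sqDist p q :=
  le_add_of_nonneg_right (by positivity)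

theorem norm_snd_sub_sq_le_sqDist (i : Fin m) : ‖p.2 i - q.2 i‖ ^ 2 ≤ sqDist p q := by
  have := Finset.single_le_sum (f := fun i => ‖p.2 i - q.2 i‖ ^ 2) (fun i _ => by positivity)
    (Finset.mem_univ i)
  exact this.trans (le_add_of_nonneg_left (by positivity))

/-- The product metric here is a sup metric, whereas the descent argument needs the Euclidean one;
this comparison passes from the latter to the former. -/
theorem dist_sq_le_sqDist : dist p q ^ 2 ≤ sqDist p q := by
  have h : dist p q ≤ √(sqDist p q) := by
    rw [Prod.dist_eq, max_le_iff]
    constructor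
    · rw [dist_eq_norm]
      exact Real.le_sqrt_of_sq_le (norm_fst_sub_sq_le_sqDist p q)
    · refine (dist_pi_le_iff (Real.sqrt_nonneg _)).2 fun i => ?_
      rw [dist_eq_norm]
      exact Real.le_sqrt_of_sq_le (norm_snd_sub_sq_le_sqDist p q i)
  calc dist p q ^ 2 ≤ √(sqDist p q) ^ 2 := by gcongr
    _ = sqDist p q := Real.sq_sqrt (sqDist_nonneg p q)

theorem norm_sub_sq_le_two_mul {d : ℕ} (a b c : Vec d) :
    ‖a - c‖ ^ 2 ≤ 2 * ‖a - b‖ ^ 2 + 2 * ‖b - c‖ ^ 2 := by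
  have h : ‖a - c‖ ≤ ‖a - b‖ + ‖b - c‖ := norm_sub_le_norm_sub_add_norm_sub a b c
  nlinarith [norm_nonneg (a - c), sq_nonneg (‖a - b‖ - ‖b - c‖)]

theorem sqDist_le_two_mul : sqDist p r ≤ 2 * sqDist p q + 2 * sqDist q r := by
  have h1 := norm_sub_sq_le_two_mul p.1 q.1 r.1
  have h2 : ∑ i, ‖p.2 i - r.2 i‖ ^ 2 ≤
      2 * ∑ i, ‖p.2 i - q.2 i‖ ^ 2 + 2 * ∑ i, ‖q.2 i - r.2 i‖ ^ 2 := by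
    rw [Finset.mul_sum, Finset.mul_sum, ← Finset.sum_add_distrib]
    exact Finset.sum_le_sum fun i _ => norm_sub_sq_le_two_mul _ _ _
  unfold sqDist
  linarith

theorem continuous_sqDist :
    Continuous fun x : (Vec d × (Fin m → Vec d)) × (Vec d × (Fin m → Vec d)) =>
      sqDist x.1 x.2 := by
  refine Continuous.add ?_ (continuous_finsetSum _ fun i _ => ?_)
  · exact ((continuous_fst.fst.sub continuous_snd.fst).norm).pow 2
  · exact ((((continuous_apply i).comp continuous_fst.snd).sub
      ((continuous_apply i).comp continuous_snd.snd)).norm).pow 2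

end sqDist

/-- A bounded sequence whose squared distances to the points of a dense subset of `S` converge and
which has a cluster point in `S` converges to that cluster point. -/
theorem tendsto_of_tendsto_sqDist {d m : ℕ} {S D : Set (Vec d × (Fin m → Vec d))}
    (hD : S ⊆ closure D) {p : ℕ → Vec d × (Fin m → Vec d)}
    (hconv : ∀ q ∈ D, ∃ l, Tendsto (fun k => sqDist (p k) q) atTop (𝓝 l))
    {φ : ℕ → ℕ} (hφ : StrictMono φ) {a : Vec d × (Fin m → Vec d)} (ha : a ∈ S)
    (hlim : Tendsto (p ∘ φ) atTop (𝓝 a)) : Tendsto p atTop (𝓝 a) := by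
  have hcont : ∀ q, Continuous fun x : Vec d × (Fin m → Vec d) => sqDist x q := fun q =>
    Continuous.comp (g := fun x : (Vec d × (Fin m → Vec d)) × (Vec d × (Fin m → Vec d)) =>
      sqDist x.1 x.2) (f := fun x => (x, q)) continuous_sqDist
      (continuous_id.prodMk continuous_const)
  have hcont' : Continuous fun q : Vec d × (Fin m → Vec d) => sqDist a q :=
    Continuous.comp (g := fun x : (Vec d × (Fin m → Vec d)) × (Vec d × (Fin m → Vec d)) =>
      sqDist x.1 x.2) (f := fun x => (a, x)) continuous_sqDist
      (continuous_const.prodMk continuous_id)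
  have haa : sqDist a a = 0 := by simp [sqDist]
  rw [Metric.tendsto_atTop]
  intro ε hε
  -- The factor 5 beats the 2 + 2 of the quasi-triangle inequality through `q`.
  have hs : 0 < ε ^ 2 / 5 := by positivity
  obtain ⟨q, hq1, hq2⟩ := mem_closure_iff.1 (hD ha) {q | sqDist a q < ε ^ 2 / 5 ∧
      sqDist q a < ε ^ 2 / 5}
    ((isOpen_lt hcont' continuous_const).inter (isOpen_lt (hcont a) continuous_const))
    ⟨by rw [haa]; exact hs, by rw [haa]; exact hs⟩
  obtain ⟨l, hl⟩ := hconv q hq2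
  have hl' : Tendsto (fun k => sqDist (p (φ k)) q) atTop (𝓝 (sqDist a q)) :=
    ((hcont q).tendsto a).comp hlim
  -- The limit along the whole sequence is identified on the subsequence, so all late iterates are
  -- as close to `q` as `a` is.
  have hla : l = sqDist a q := tendsto_nhds_unique (hl.comp hφ.tendsto_atTop) hl'
  have hev := hl.eventually (gt_mem_nhds (show l < ε ^ 2 / 5 by rw [hla]; exact hq1.1))
  obtain ⟨N, hN⟩ := eventually_atTop.1 hev
  refine ⟨N, fun k hk => ?_⟩
  have h1 := sqDist_le_two_mul (p k) q a
  have h2 := dist_sq_le_sqDist (p k) a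
  have h3 := hN k hk
  refine lt_of_pow_lt_pow_left₀ 2 hε.le ?_
  have := hq1.2
  linarith

end SPS

namespace SPS

/-! ### Pathwise estimates for a single run -/

section Deterministic

variable {d n : ℕ} {A : Fin n → Vec d → Set (Vec d)} {B : Vec d → Vec d} {τ : ℝ}
  {α ρ : ℕ → ℝ} {ε e z : ℕ → Vec d} {w x y : ℕ → Fin (n + 1) → Vec d}

theorem sum_sub_average_eq_zero (u : Fin (n + 1) → Vec d) :
    ∑ i, (u i - ((n : ℝ) + 1)⁻¹ • ∑ j, u j) = 0 := by
  have h : (n : ℝ) + 1 ≠ 0 := by positivity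
  rw [Finset.sum_sub_distrib, Finset.sum_const, Finset.card_univ, Fintype.card_fin,
    ← Nat.cast_smul_eq_nsmul ℝ, smul_smul]
  push_cast
  rw [mul_inv_cancel₀ h, one_smul, sub_self]

theorem IsRun.sum_w_eq_zero (h : IsRun A B τ α ρ ε e z w x y) (k : ℕ) : ∑ i, w k i = 0 := by
  induction k with
  | zero => exact h.sum_w_zero
  | succ k ih =>
    simp_rw [h.w_succ k, Finset.sum_sub_distrib (f := w k), ih, ← Finset.smul_sum,
      sum_sub_average_eq_zero, smul_zero, sub_zero]

theorem IsRun.y_mem (h : IsRun A B τ α ρ ε e z w x y) (hτ : 0 < τ) (k : ℕ) (i : Fin n) :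
    y k i.castSucc ∈ A i (x k i.castSucc) := by
  rw [h.y_resolvent]
  exact inv_smul_sub_mem_of_mem_resolventOp hτ (h.x_resolvent k i)

theorem IsRun.x_add_smul_y (h : IsRun A B τ α ρ ε e z w x y) (hτ : 0 < τ) (k : ℕ) (i : Fin n) :
    x k i.castSucc + τ • y k i.castSucc = z k + τ • w k i.castSucc := by
  rw [h.y_resolvent, smul_smul, mul_inv_cancel₀ hτ.ne', one_smul]
  abel

theorem IsRun.z_sub_x (h : IsRun A B τ α ρ ε e z w x y) (hτ : 0 < τ) (k : ℕ) (i : Fin n) :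
    z k - x k i.castSucc = τ • (y k i.castSucc - w k i.castSucc) := by
  have := h.x_add_smul_y hτ k i
  rw [smul_sub, sub_eq_sub_iff_add_eq_add, ← this]
  abel

theorem inner_block_eq (a x z y w zs ws : Vec d) (ha : a = z - zs) :
    inner ℝ a (y - ws) + inner ℝ (w - ws) (x - zs) =
      inner ℝ (z - x) (y - w) + inner ℝ (x - zs) (y - ws) + inner ℝ a (w - ws) := by
  subst ha
  simp only [inner_sub_left, inner_sub_right, real_inner_comm]
  ring

/-- The first-order sum is the value at `p^k` minus the value at `q` of `(z, w) ↦ ∑ ⟨z - x_i, y_i -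
w_i⟩`, which is affine on the subspace `∑ w_i = 0`. Only this linear constraint on `q` is needed. -/
theorem IsRun.sqDist_succ (h : IsRun A B τ α ρ ε e z w x y)
    {q : Vec d × (Fin (n + 1) → Vec d)} (hq : ∑ i, q.2 i = 0) (k : ℕ) :
    sqDist (z (k + 1), w (k + 1)) q = sqDist (z k, w k) q
      - 2 * α k * ∑ i, (inner ℝ (z k - x k i) (y k i - w k i)
          + inner ℝ (x k i - q.1) (y k i - q.2 i))
      + α k ^ 2 * (‖∑ i, y k i‖ ^ 2
          + ∑ i, ‖x k i - ((n : ℝ) + 1)⁻¹ • ∑ j, x k j‖ ^ 2) := by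
  set m : Vec d := ((n : ℝ) + 1)⁻¹ • ∑ j, x k j with hm
  have hww : ∑ i, (w k i - q.2 i) = 0 := by
    rw [Finset.sum_sub_distrib, h.sum_w_eq_zero k, hq, sub_zero]
  have hz : ‖z (k + 1) - q.1‖ ^ 2 = ‖z k - q.1‖ ^ 2
      - 2 * α k * inner ℝ (z k - q.1) (∑ i, y k i) + α k ^ 2 * ‖∑ i, y k i‖ ^ 2 := by
    rw [h.z_succ, sub_right_comm, norm_sub_sq_real, inner_smul_right, norm_smul, mul_pow,
      Real.norm_eq_abs, sq_abs]
    ring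
  have hw : ∀ i, ‖w (k + 1) i - q.2 i‖ ^ 2 = ‖w k i - q.2 i‖ ^ 2
      - 2 * α k * inner ℝ (w k i - q.2 i) (x k i - m) + α k ^ 2 * ‖x k i - m‖ ^ 2 := by
    intro i
    rw [h.w_succ, ← hm, sub_right_comm, norm_sub_sq_real, inner_smul_right, norm_smul, mul_pow,
      Real.norm_eq_abs, sq_abs]
    ring
  have h1 : inner ℝ (z k - q.1) (∑ i, y k i) = ∑ i, inner ℝ (z k - q.1) (y k i - q.2 i) := by
    rw [← inner_sum, Finset.sum_sub_distrib, hq, sub_zero]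
  have h2 : ∑ i, inner ℝ (w k i - q.2 i) (x k i - m)
      = ∑ i, inner ℝ (w k i - q.2 i) (x k i - q.1) := by
    -- The dual differences sum to zero, so any common offset drops out and the mean `m` may be
    -- traded for `q.1`.
    have : ∀ c, ∑ i, inner ℝ (w k i - q.2 i) (x k i - c)
        = ∑ i, inner ℝ (w k i - q.2 i) (x k i) := by
      intro c
      simp_rw [inner_sub_right (w k _ - q.2 _) (x k _) c]
      rw [Finset.sum_sub_distrib, ← sum_inner, hww, inner_zero_left, sub_zero]
    rw [this, this]
  have h3 : ∑ i, inner ℝ (z k - q.1) (w k i - q.2 i) = (0 : ℝ) := by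
    rw [← inner_sum, hww, inner_zero_right]
  have h4 : ∑ i, inner ℝ (z k - q.1) (y k i - q.2 i)
        + ∑ i, inner ℝ (w k i - q.2 i) (x k i - q.1)
      = ∑ i, (inner ℝ (z k - x k i) (y k i - w k i)
          + inner ℝ (x k i - q.1) (y k i - q.2 i)) := by
    rw [← Finset.sum_add_distrib]
    simp_rw [inner_block_eq (z k - q.1) (x k _) (z k) (y k _) (w k _) q.1 (q.2 _) rfl]
    rw [Finset.sum_add_distrib, h3, add_zero]
  unfold sqDist
  simp only
  rw [hz, Finset.sum_congr rfl fun i _ => hw i, Finset.sum_add_distrib, Finset.sum_sub_distrib,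
    ← Finset.mul_sum, ← Finset.mul_sum, ← h4, h1, h2]
  ring

/-- Replacing `B x` by `B z` costs at most `L‖z - x‖²`, and `z - x = r((B z - w) + ε)` turns this
into the `L r²` corrections. The contributions of `e` add up to `⟨z - zs, e⟩`: the point `x`, which
depends on `ε`, cancels, so a zero mean of `e` given the past is enough. -/
theorem lipschitz_block_lower_bound {L : ℝ≥0} (hBlip : LipschitzWith L B)
    (hBmono : ∀ u v : Vec d, 0 ≤ inner ℝ (B u - B v) (u - v))
    {r : ℝ} {z x w ε e : Vec d} (hx : x = z - r • ((B z + ε) - w)) (zs : Vec d) :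
    r * (1 - r * L) * ‖B z - w‖ ^ 2 + inner ℝ (z - zs) e
        + (r - 2 * L * r ^ 2) * inner ℝ (B z - w) ε - L * r ^ 2 * ‖ε‖ ^ 2
      ≤ inner ℝ (z - x) ((B x + e) - w) + inner ℝ (x - zs) ((B x + e) - B zs) := by
  have hzx : z - x = r • ((B z - w) + ε) := by
    rw [hx, sub_sub_cancel]
    congr 1
    abel
  have hsq : ‖z - x‖ ^ 2 = r ^ 2 * (‖B z - w‖ ^ 2 + 2 * inner ℝ (B z - w) ε + ‖ε‖ ^ 2) := by
    rw [hzx, norm_smul, mul_pow, Real.norm_eq_abs, sq_abs, norm_add_sq_real]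
  have h1 : inner ℝ (z - x) (B z - w) = r * (‖B z - w‖ ^ 2 + inner ℝ (B z - w) ε) := by
    rw [hzx, inner_smul_left, inner_add_left, real_inner_self_eq_norm_sq, real_inner_comm]
    simp
  have h2 : -(L * ‖z - x‖ ^ 2) ≤ inner ℝ (z - x) (B x - B z) := by
    have ha := abs_real_inner_le_norm (z - x) (B x - B z)
    have hb : ‖B x - B z‖ ≤ L * ‖z - x‖ := by
      rw [norm_sub_rev z x]
      exact hBlip.norm_sub_le x z
    have hc : ‖z - x‖ * ‖B x - B z‖ ≤ L * ‖z - x‖ ^ 2 := by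
      calc _ ≤ ‖z - x‖ * (L * ‖z - x‖) := by gcongr
        _ = _ := by ring
    linarith [(abs_le.1 ha).1]
  have h3 : 0 ≤ inner ℝ (x - zs) (B x - B zs) := by
    rw [real_inner_comm]
    exact hBmono x zs
  have h4 : inner ℝ (z - x) ((B x + e) - w) + inner ℝ (x - zs) ((B x + e) - B zs)
      = inner ℝ (z - x) (B z - w) + inner ℝ (z - x) (B x - B z)
        + inner ℝ (x - zs) (B x - B zs) + inner ℝ (z - zs) e := by
    simp only [inner_sub_left, inner_sub_right, inner_add_right]
    ring
  rw [h4, h1]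
  rw [hsq] at h2
  nlinarith

theorem sum_norm_sub_average_sq_le (u : Fin (n + 1) → Vec d) (c : Vec d) :
    ∑ i, ‖u i - ((n : ℝ) + 1)⁻¹ • ∑ j, u j‖ ^ 2 ≤ ∑ i, ‖u i - c‖ ^ 2 := by
  set m : Vec d := ((n : ℝ) + 1)⁻¹ • ∑ j, u j
  have h : ∀ i, ‖u i - c‖ ^ 2 = ‖u i - m‖ ^ 2 + 2 * inner ℝ (u i - m) (m - c) + ‖m - c‖ ^ 2 := by
    intro i
    rw [← norm_add_sq_real, sub_add_sub_cancel]
  rw [Finset.sum_congr rfl fun i _ => h i, Finset.sum_add_distrib, Finset.sum_add_distrib,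
    ← Finset.mul_sum, ← sum_inner, sum_sub_average_eq_zero, inner_zero_left]
  have : 0 ≤ ∑ _i : Fin (n + 1), ‖m - c‖ ^ 2 := by positivity
  linarith

theorem norm_sum_sq_le {ι : Type*} (s : Finset ι) (u : ι → Vec d) :
    ‖∑ i ∈ s, u i‖ ^ 2 ≤ s.card * ∑ i ∈ s, ‖u i‖ ^ 2 := by
  calc ‖∑ i ∈ s, u i‖ ^ 2 ≤ (∑ i ∈ s, ‖u i‖) ^ 2 := by
        gcongr
        exact norm_sum_le _ _
    _ ≤ _ := sq_sum_le_card_mul_sum_sq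

/-- Since `x_i + τ y_i = z + τ w_i`, `norm_sq_add_le` bounds `‖x_i - q.1‖² + τ²‖y_i - q.2 i‖²` by
the distance to `q`; the factor `1 + τ⁻²` removes the weight `τ²`. These blocks carry no noise. -/
theorem IsRun.resolvent_block_upper_bound (h : IsRun A B τ α ρ ε e z w x y) (hτ : 0 < τ)
    (hA : ∀ i, IsMonotoneOp (A i)) {q : Vec d × (Fin (n + 1) → Vec d)}
    (hq : q ∈ extendedSolutionSet A B) (k : ℕ) (i : Fin n) :
    ‖x k i.castSucc - q.1‖ ^ 2 + ‖y k i.castSucc - q.2 i.castSucc‖ ^ 2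
      ≤ 2 * (1 + τ ^ 2) * (1 + (τ ^ 2)⁻¹) * sqDist (z k, w k) q := by
  have h1 := (hA i).norm_sq_add_le hτ (h.y_mem hτ k i) (hq.1 i)
  rw [h.x_add_smul_y hτ, add_sub_add_comm, ← smul_sub] at h1
  have h2 := norm_sub_sq_le_two_mul (z k - q.1) 0 (-(τ • (w k i.castSucc - q.2 i.castSucc)))
  rw [sub_neg_eq_add, sub_zero, zero_sub, neg_neg, norm_smul, mul_pow, Real.norm_eq_abs,
    sq_abs] at h2
  have h3 := norm_fst_sub_sq_le_sqDist (z k, w k) q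
  have h4 := norm_snd_sub_sq_le_sqDist (z k, w k) q i.castSucc
  simp only at h3 h4
  set V := sqDist (z k, w k) q
  set a := ‖x k i.castSucc - q.1‖ ^ 2
  set b := ‖y k i.castSucc - q.2 i.castSucc‖ ^ 2
  have ha : 0 ≤ a := by positivity
  have hb : 0 ≤ b := by positivity
  have ht : 0 < τ ^ 2 := by positivity
  have h5 : a + τ ^ 2 * b ≤ 2 * (1 + τ ^ 2) * V := by nlinarith
  calc a + b ≤ (1 + (τ ^ 2)⁻¹) * (a + τ ^ 2 * b) := by
        have : (1 + (τ ^ 2)⁻¹) * (a + τ ^ 2 * b) = a + b + (τ ^ 2 * b + (τ ^ 2)⁻¹ * a) := by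
          field_simp
          ring
        rw [this]
        have : 0 ≤ τ ^ 2 * b + (τ ^ 2)⁻¹ * a := by positivity
        linarith
    _ ≤ (1 + (τ ^ 2)⁻¹) * (2 * (1 + τ ^ 2) * V) := by gcongr
    _ = _ := by ring

theorem IsRun.x_last_upper_bound (h : IsRun A B τ α ρ ε e z w x y) {L : ℝ≥0}
    (hBlip : LipschitzWith L B) {ρbar : ℝ} (hρ : ∀ k, 0 ≤ ρ k) (hρbar : ∀ k, ρ k ≤ ρbar)
    {q : Vec d × (Fin (n + 1) → Vec d)} (hq : q ∈ extendedSolutionSet A B) (k : ℕ) :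
    ‖x k (Fin.last n) - q.1‖ ^ 2
      ≤ 3 * ((1 + ρbar * L) ^ 2 + ρbar ^ 2) * (sqDist (z k, w k) q + ‖ε k‖ ^ 2) := by
  have h3 := norm_fst_sub_sq_le_sqDist (z k, w k) q
  have h4 := norm_snd_sub_sq_le_sqDist (z k, w k) q (Fin.last n)
  have h0 : 0 ≤ ρbar := (hρ k).trans (hρbar k)
  have e1 : x k (Fin.last n) - q.1 = (z k - q.1) - ρ k • (B (z k) - B q.1) - ρ k • ε k
      + ρ k • (w k (Fin.last n) - q.2 (Fin.last n)) := by
    rw [h.x_last, hq.2.1]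
    module
  have n1 : ‖x k (Fin.last n) - q.1‖ ≤ (1 + ρbar * L) * ‖z k - q.1‖ + ρbar * ‖ε k‖
      + ρbar * ‖w k (Fin.last n) - q.2 (Fin.last n)‖ := by
    rw [e1]
    refine (norm_add_le _ _).trans ?_
    have a1 := norm_sub_le ((z k - q.1) - ρ k • (B (z k) - B q.1)) (ρ k • ε k)
    have a2 := norm_sub_le (z k - q.1) (ρ k • (B (z k) - B q.1))
    have a3 := hBlip.norm_sub_le (z k) q.1
    rw [norm_smul, Real.norm_of_nonneg (hρ k)] at a1 a2 ⊢
    have b1 : ρ k * ‖ε k‖ ≤ ρbar * ‖ε k‖ := by gcongr; exact hρbar k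
    have b2 : ρ k * ‖w k (Fin.last n) - q.2 (Fin.last n)‖
        ≤ ρbar * ‖w k (Fin.last n) - q.2 (Fin.last n)‖ := by gcongr; exact hρbar k
    have b3 : ρ k * ‖B (z k) - B q.1‖ ≤ ρbar * (L * ‖z k - q.1‖) := by gcongr; exact hρbar k
    linarith
  simp only at h3 h4
  set V := sqDist (z k, w k) q
  set a := ‖z k - q.1‖
  set b := ‖ε k‖
  set c := ‖w k (Fin.last n) - q.2 (Fin.last n)‖
  set t := 1 + ρbar * L
  calc ‖x k (Fin.last n) - q.1‖ ^ 2 ≤ (t * a + ρbar * b + ρbar * c) ^ 2 := by gcongr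
    _ ≤ 3 * (t ^ 2 * a ^ 2 + ρbar ^ 2 * b ^ 2 + ρbar ^ 2 * c ^ 2) := by
        nlinarith [sq_nonneg (t * a - ρbar * b), sq_nonneg (t * a - ρbar * c),
          sq_nonneg (ρbar * b - ρbar * c)]
    _ ≤ 3 * (t ^ 2 * V + ρbar ^ 2 * b ^ 2 + ρbar ^ 2 * V) := by gcongr
    _ ≤ 3 * (t ^ 2 + ρbar ^ 2) * (V + b ^ 2) := by
        have : 0 ≤ t ^ 2 * b ^ 2 := by positivity
        linarith

/-- How far an iterate is from satisfying the inclusions defining the extended solution set. -/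
noncomputable def residual (B : Vec d → Vec d) (z : Vec d) (w y : Fin (n + 1) → Vec d) : ℝ :=
  ∑ i : Fin n, ‖y i.castSucc - w i.castSucc‖ ^ 2 + ‖B z - w (Fin.last n)‖ ^ 2

theorem residual_nonneg (B : Vec d → Vec d) (z : Vec d) (w y : Fin (n + 1) → Vec d) :
    0 ≤ residual B z w y := by unfold residual; positivity

/-- A resolvent block contributes `τ‖y_i - w_i‖²` and the last block `ρ_k(1 - ρ_k L)‖B z - w‖²`; the
two conditions on `c` make `c ρ_k` a common lower bound for these coefficients. -/
theorem IsRun.gap_lower_bound (h : IsRun A B τ α ρ ε e z w x y) (hτ : 0 < τ)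
    (hA : ∀ i, IsMonotoneOp (A i)) {L : ℝ≥0} (hBlip : LipschitzWith L B)
    (hBmono : ∀ u v : Vec d, 0 ≤ inner ℝ (B u - B v) (u - v))
    {ρbar : ℝ} (hρ : ∀ k, 0 ≤ ρ k) (hρbar : ∀ k, ρ k ≤ ρbar)
    {c : ℝ} (hc : 0 ≤ c) (hcτ : c * ρbar ≤ τ) (hcL : c ≤ 1 - ρbar * L)
    {q : Vec d × (Fin (n + 1) → Vec d)} (hq : q ∈ extendedSolutionSet A B) (k : ℕ) :
    c * ρ k * residual B (z k) (w k) (y k) + inner ℝ (z k - q.1) (e k)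
        + (ρ k - 2 * L * ρ k ^ 2) * inner ℝ (B (z k) - w k (Fin.last n)) (ε k)
        - L * ρ k ^ 2 * ‖ε k‖ ^ 2
      ≤ ∑ i, (inner ℝ (z k - x k i) (y k i - w k i)
          + inner ℝ (x k i - q.1) (y k i - q.2 i)) := by
  have h1 : ∀ i : Fin n, c * ρ k * ‖y k i.castSucc - w k i.castSucc‖ ^ 2
      ≤ inner ℝ (z k - x k i.castSucc) (y k i.castSucc - w k i.castSucc)
        + inner ℝ (x k i.castSucc - q.1) (y k i.castSucc - q.2 i.castSucc) := by
    intro i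
    have h2 := hA i (h.y_mem hτ k i) (hq.1 i)
    rw [real_inner_comm] at h2
    rw [h.z_sub_x hτ, inner_smul_left, real_inner_self_eq_norm_sq, RCLike.conj_to_real]
    have h3 : c * ρ k ≤ τ := (mul_le_mul_of_nonneg_left (hρbar k) hc).trans hcτ
    have := mul_le_mul_of_nonneg_right h3 (sq_nonneg ‖y k i.castSucc - w k i.castSucc‖)
    linarith
  have h2 := lipschitz_block_lower_bound hBlip hBmono (e := e k) (h.x_last k) q.1
  rw [Fin.sum_univ_castSucc, h.y_last, hq.2.1]
  have h3 := Finset.sum_le_sum fun i (_ : i ∈ (Finset.univ : Finset (Fin n))) => h1 i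
  rw [← Finset.mul_sum] at h3
  have h4 : c * ρ k * ‖B (z k) - w k (Fin.last n)‖ ^ 2
      ≤ ρ k * (1 - ρ k * L) * ‖B (z k) - w k (Fin.last n)‖ ^ 2 := by
    gcongr ?_ * _
    rw [mul_comm]
    refine mul_le_mul_of_nonneg_left (hcL.trans ?_) (hρ k)
    have := mul_le_mul_of_nonneg_right (hρbar k) L.2
    exact sub_le_sub_left this 1
  unfold residual
  linarith

/-- The constant is fixed before the run, so one value serves every `ω` and every `k`. -/
theorem exists_one_step_bound (A : Fin n → Vec d → Set (Vec d)) (hA : ∀ i, IsMonotoneOp (A i))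
    {L : ℝ≥0} (hBlip : LipschitzWith L B)
    (hBmono : ∀ u v : Vec d, 0 ≤ inner ℝ (B u - B v) (u - v)) (hτ : 0 < τ) (ρbar : ℝ)
    {c : ℝ} (hc : 0 ≤ c) (hcτ : c * ρbar ≤ τ) (hcL : c ≤ 1 - ρbar * L)
    {q : Vec d × (Fin (n + 1) → Vec d)} (hq : q ∈ extendedSolutionSet A B) :
    ∃ C : ℝ, 0 ≤ C ∧ ∀ {α ρ : ℕ → ℝ} {ε e z : ℕ → Vec d} {w x y : ℕ → Fin (n + 1) → Vec d},
      IsRun A B τ α ρ ε e z w x y → (∀ k, 0 ≤ α k) → (∀ k, 0 ≤ ρ k) → (∀ k, ρ k ≤ ρbar) → ∀ k,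
      sqDist (z (k + 1), w (k + 1)) q + 2 * c * (α k * ρ k) * residual B (z k) (w k) (y k)
        ≤ sqDist (z k, w k) q - 2 * α k * inner ℝ (z k - q.1) (e k)
          - 2 * α k * (ρ k - 2 * L * ρ k ^ 2) * inner ℝ (B (z k) - w k (Fin.last n)) (ε k)
          + 2 * L * (α k * ρ k ^ 2) * ‖ε k‖ ^ 2
          + C * α k ^ 2 * (sqDist (z k, w k) q + ‖ε k‖ ^ 2 + ‖e k‖ ^ 2) := by
  set C₁ : ℝ := 3 * ((1 + ρbar * L) ^ 2 + ρbar ^ 2) with hC₁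
  set C₂ : ℝ := 2 * (1 + τ ^ 2) * (1 + (τ ^ 2)⁻¹) with hC₂
  have hC₁0 : 0 ≤ C₁ := by positivity
  have hC₂0 : 0 ≤ C₂ := by positivity
  -- Each of the `n` resolvent blocks costs `C₂`; the last costs `C₁` for `x` and `2 L² C₁ + 2` for
  -- `y`. The factor `n + 1` is Cauchy–Schwarz for `∑ y_i`, rewritten as `∑ (y_i - q.2 i)`.
  refine ⟨((n : ℝ) + 1) * (n * C₂ + (C₁ + 2 * L ^ 2 * C₁ + 2)), by positivity, ?_⟩
  intro α ρ ε e z w x y h hα hρ hρbar k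
  have h1 := h.gap_lower_bound hτ hA hBlip hBmono hρ hρbar hc hcτ hcL hq k
  have h2 := h.sqDist_succ hq.2.2 k
  have h3 : ‖∑ i, y k i‖ ^ 2 ≤ ((n : ℝ) + 1) * ∑ i, ‖y k i - q.2 i‖ ^ 2 := by
    have := norm_sum_sq_le Finset.univ fun i => y k i - q.2 i
    rw [Finset.sum_sub_distrib, hq.2.2, sub_zero, Finset.card_univ, Fintype.card_fin] at this
    exact_mod_cast this
  have h4 := sum_norm_sub_average_sq_le (x k) q.1
  have hV := sqDist_nonneg (z k, w k) q
  have h5 := h.x_last_upper_bound hBlip hρ hρbar hq k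
  have h6 : ‖y k (Fin.last n) - q.2 (Fin.last n)‖ ^ 2
      ≤ 2 * L ^ 2 * ‖x k (Fin.last n) - q.1‖ ^ 2 + 2 * ‖e k‖ ^ 2 := by
    have a1 := norm_add_le (B (x k (Fin.last n)) - B q.1) (e k)
    have a2 := hBlip.norm_sub_le (x k (Fin.last n)) q.1
    rw [h.y_last, hq.2.1, add_sub_right_comm]
    set s := ‖x k (Fin.last n) - q.1‖
    calc _ ≤ (L * s + ‖e k‖) ^ 2 := by gcongr; linarith
      _ ≤ _ := by nlinarith [sq_nonneg (L * s - ‖e k‖)]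
  have h7 : ∑ i, (‖x k i - q.1‖ ^ 2 + ‖y k i - q.2 i‖ ^ 2)
      ≤ (n * C₂ + (C₁ + 2 * L ^ 2 * C₁ + 2)) * (sqDist (z k, w k) q + ‖ε k‖ ^ 2 + ‖e k‖ ^ 2) := by
    rw [Fin.sum_univ_castSucc]
    have b1 := Finset.sum_le_sum fun i (_ : i ∈ (Finset.univ : Finset (Fin n))) =>
      h.resolvent_block_upper_bound hτ hA hq k i
    rw [Finset.sum_const, Finset.card_univ, Fintype.card_fin, nsmul_eq_mul, ← hC₂] at b1
    rw [← hC₁] at h5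
    set V := sqDist (z k, w k) q
    have b2 : 2 * L ^ 2 * ‖x k (Fin.last n) - q.1‖ ^ 2 ≤ 2 * L ^ 2 * (C₁ * (V + ‖ε k‖ ^ 2)) := by
      gcongr
    have b3 : 0 ≤ n * C₂ * (‖ε k‖ ^ 2 + ‖e k‖ ^ 2) := by positivity
    have b4 : 0 ≤ (C₁ + 2 * L ^ 2 * C₁) * ‖e k‖ ^ 2 := by positivity
    have b5 : 0 ≤ 2 * (V + ‖ε k‖ ^ 2) := by positivity
    linarith
  have h8 : ‖∑ i, y k i‖ ^ 2 + ∑ i, ‖x k i - ((n : ℝ) + 1)⁻¹ • ∑ j, x k j‖ ^ 2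
      ≤ ((n : ℝ) + 1) * (n * C₂ + (C₁ + 2 * L ^ 2 * C₁ + 2))
        * (sqDist (z k, w k) q + ‖ε k‖ ^ 2 + ‖e k‖ ^ 2) := by
    rw [Finset.sum_add_distrib] at h7
    have c1 : 0 ≤ n * ∑ i, ‖x k i - q.1‖ ^ 2 := by positivity
    have c2 := mul_le_mul_of_nonneg_left h7 (show (0 : ℝ) ≤ n + 1 by positivity)
    linarith
  have h9 := mul_le_mul_of_nonneg_left h8 (sq_nonneg (α k))
  have h10 := mul_le_mul_of_nonneg_left h1 (show 0 ≤ 2 * α k by linarith [hα k])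
  rw [h2]
  linarith

/-- A bounded run along which the residuals are summable with non-summable weights has a cluster
point in the extended solution set. -/
theorem IsRun.exists_cluster_point (h : IsRun A B τ α ρ ε e z w x y) (hτ : 0 < τ)
    (hA : ∀ i, IsMaximalMonotone (A i)) (hB : Continuous B)
    {b : ℕ → ℝ} (hb : ∀ k, 0 ≤ b k)
    (hbsum : Tendsto (fun K : ℕ => ∑ k ∈ Finset.range K, b k) atTop atTop)
    (hres : Summable fun k => b k * residual B (z k) (w k) (y k))
    {q : Vec d × (Fin (n + 1) → Vec d)} {l : ℝ}
    (hq : Tendsto (fun k => sqDist (z k, w k) q) atTop (𝓝 l)) :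
    ∃ a ∈ extendedSolutionSet A B, ∃ φ : ℕ → ℕ, StrictMono φ ∧
      Tendsto ((fun k => (z k, w k)) ∘ φ) atTop (𝓝 a) := by
  -- A residual eventually bounded below would make the weights `b` summable.
  have hfreq : ∀ m : ℕ, ∃ᶠ k in atTop, residual B (z k) (w k) (y k) < 1 / ((m : ℝ) + 1) := by
    intro m hcon
    have hev : ∀ᶠ k in atTop, 1 / ((m : ℝ) + 1) ≤ residual B (z k) (w k) (y k) := by
      filter_upwards [hcon] with k hk using not_lt.1 hk
    have hm : (0 : ℝ) < m + 1 := by positivity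
    have hsum : Summable b := by
      refine Summable.of_norm_bounded_eventually_nat
        (hres.mul_left ((m : ℝ) + 1)) ?_
      filter_upwards [hev] with k hk
      rw [Real.norm_of_nonneg (hb k)]
      rw [div_le_iff₀ hm] at hk
      nlinarith [mul_le_mul_of_nonneg_left hk (hb k)]
    exact not_tendsto_nhds_of_tendsto_atTop hbsum _ hsum.hasSum.tendsto_sum_nat
  obtain ⟨φ, hφ, hφres⟩ := extraction_forall_of_frequently hfreq
  have hres0 : Tendsto (fun m => residual B (z (φ m)) (w (φ m)) (y (φ m))) atTop (𝓝 0) :=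
    squeeze_zero (fun m => residual_nonneg _ _ _ _) (fun m => (hφres m).le)
      tendsto_one_div_add_atTop_nhds_zero_nat
  obtain ⟨M, hM⟩ := hq.bddAbove_range
  have hbdd : ∀ m, (z (φ m), w (φ m)) ∈ Metric.closedBall q (√M) := by
    intro m
    refine Metric.mem_closedBall.2 (Real.le_sqrt_of_sq_le ?_)
    exact (dist_sq_le_sqDist _ _).trans (hM ⟨φ m, rfl⟩)
  obtain ⟨a, -, ψ, hψ, hlim⟩ :=
    tendsto_subseq_of_bounded Metric.isBounded_closedBall hbdd
  refine ⟨a, ?_, φ ∘ ψ, hφ.comp hψ, hlim⟩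
  have hz : Tendsto (fun m => z (φ (ψ m))) atTop (𝓝 a.1) := hlim.fst_nhds
  have hw : ∀ i, Tendsto (fun m => w (φ (ψ m)) i) atTop (𝓝 (a.2 i)) :=
    fun i => (tendsto_pi_nhds.1 hlim.snd_nhds) i
  have hres1 := hres0.comp hψ.tendsto_atTop
  have hsq : ∀ u : ℕ → Vec d, (∀ m, ‖u m‖ ^ 2 ≤
      residual B (z (φ (ψ m))) (w (φ (ψ m))) (y (φ (ψ m)))) → Tendsto u atTop (𝓝 0) := by
    intro u hu
    have h2 : Tendsto (fun m => ‖u m‖ ^ 2) atTop (𝓝 0) :=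
      squeeze_zero (fun m => by positivity) hu hres1
    have h3 := h2.sqrt
    simp only [Real.sqrt_zero, Real.sqrt_sq (norm_nonneg _)] at h3
    exact tendsto_zero_iff_norm_tendsto_zero.2 h3
  have hyw : ∀ i : Fin n, Tendsto (fun m => y (φ (ψ m)) i.castSucc - w (φ (ψ m)) i.castSucc)
      atTop (𝓝 0) := by
    refine fun i => hsq _ fun m => ?_
    refine (Finset.single_le_sum (f := fun i : Fin n =>
      ‖y (φ (ψ m)) i.castSucc - w (φ (ψ m)) i.castSucc‖ ^ 2) (fun i _ => by positivity)
      (Finset.mem_univ i)).trans ?_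
    exact le_add_of_nonneg_right (by positivity)
  refine ⟨fun i => ?_, ?_, ?_⟩
  · refine (hA i).mem_of_tendsto (x := fun m => x (φ (ψ m)) i.castSucc)
      (u := fun m => y (φ (ψ m)) i.castSucc) (fun m => h.y_mem hτ _ i) ?_ ?_
    · have := hz.sub ((hyw i).const_smul τ)
      simp only [smul_zero, sub_zero, ← h.z_sub_x hτ, sub_sub_cancel] at this
      exact this
    · simpa using (hyw i).add (hw i.castSucc)
  · have h1 : Tendsto (fun m => B (z (φ (ψ m))) - w (φ (ψ m)) (Fin.last n)) atTop (𝓝 0) :=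
      hsq _ fun m => le_add_of_nonneg_left (by positivity)
    have h2 := ((hB.tendsto _).comp hz).sub (hw (Fin.last n))
    exact (sub_eq_zero.1 (tendsto_nhds_unique h2 h1)).symm
  · refine tendsto_nhds_unique (tendsto_finsetSum _ fun i _ => hw i) ?_
    simp [h.sum_w_eq_zero]

end Deterministic

end SPS

namespace SPS

/-! ### Martingale orthogonality and the Robbins–Siegmund theorem -/

section Probability

/-- The truncation `s.indicator f` is bounded and `m`-measurable, so it can be pulled out of the
conditional expectation; `f` itself need not be integrable. -/
theorem integrableOn_inner_and_setIntegral_inner_eq_zero {Ω E : Type*} [NormedAddCommGroup E]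
    [InnerProductSpace ℝ E] [CompleteSpace E] {m m0 : MeasurableSpace Ω} {μ : Measure Ω}
    [IsFiniteMeasure μ] (hm : m ≤ m0) {f g : Ω → E} (hf : StronglyMeasurable[m] f)
    (hg : Integrable g μ) (hg0 : μ[g | m] =ᵐ[μ] 0) {s : Set Ω} (hs : MeasurableSet[m] s)
    {M : ℝ} (hM : ∀ ω ∈ s, ‖f ω‖ ≤ M) :
    IntegrableOn (fun ω => (inner ℝ (f ω) (g ω) : ℝ)) s μ ∧
      ∫ ω in s, (inner ℝ (f ω) (g ω) : ℝ) ∂μ = 0 := by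
  have hfs : StronglyMeasurable[m] (s.indicator f) := hf.indicator hs
  have hbound : ∀ ω, ‖s.indicator f ω‖ ≤ max M 0 := by
    intro ω
    by_cases h : ω ∈ s
    · rw [Set.indicator_of_mem h]
      exact (hM ω h).trans (le_max_left _ _)
    · rw [Set.indicator_of_notMem h, norm_zero]
      exact le_max_right _ _
  have hint : Integrable (fun ω => innerSL ℝ (s.indicator f ω) (g ω)) μ := by
    refine (hg.norm.const_mul (max M 0)).mono' ?_ (ae_of_all _ fun ω => ?_)
    · simp only [innerSL_apply_apply]
      exact (hfs.mono hm).aestronglyMeasurable.inner hg.aestronglyMeasurable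
    · rw [innerSL_apply_apply]
      refine (norm_inner_le_norm _ _).trans ?_
      gcongr
      exact hbound ω
  have hpull := condExp_bilin_of_stronglyMeasurable_left (innerSL ℝ) hfs hint hg
  have hzero : ∫ ω, innerSL ℝ (s.indicator f ω) (g ω) ∂μ = 0 := by
    rw [← integral_condExp hm, integral_eq_zero_of_ae]
    filter_upwards [hpull, hg0] with ω h1 h2
    rw [h1, h2]
    simp
  have heq : (fun ω => innerSL ℝ (s.indicator f ω) (g ω))
      = s.indicator fun ω => (inner ℝ (f ω) (g ω) : ℝ) := by
    ext ω
    by_cases h : ω ∈ s <;> simp [h]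
  rw [heq] at hint hzero
  rw [integral_indicator (hm _ hs)] at hzero
  exact ⟨(integrable_indicator_iff (hm _ hs)).1 hint, hzero⟩

theorem lintegral_enorm_sq_le_of_condLExp_le {Ω E : Type*} [NormedAddCommGroup E]
    {m m0 : MeasurableSpace Ω} {μ : Measure Ω} [IsFiniteMeasure μ] (hm : m ≤ m0) {f : Ω → E}
    {b : Ω → ℝ≥0∞} (h : ∀ᵐ ω ∂μ, condLExp m μ (fun ω' => ‖f ω'‖ₑ ^ 2) ω ≤ b ω)
    {s : Set Ω} (hs : MeasurableSet[m] s) :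
    ∫⁻ ω in s, ‖f ω‖ₑ ^ 2 ∂μ ≤ ∫⁻ ω in s, b ω ∂μ := by
  rw [← setLIntegral_condLExp hm μ _ hs]
  exact lintegral_mono_ae (ae_restrict_of_ae h)

theorem one_le_prod_one_add {ι : Type*} (s : Finset ι) {a : ι → ℝ} (ha : ∀ j, 0 ≤ a j) :
    1 ≤ ∏ j ∈ s, (1 + a j) := by
  simpa using Finset.prod_le_prod (s := s) (f := fun _ => (1 : ℝ)) (g := fun j => 1 + a j)
    (fun _ _ => zero_le_one) fun j _ => by linarith [ha j]

/-- The deterministic part of the Robbins-Siegmund argument. -/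
theorem tendsto_and_summable_of_discounted {a u g P : ℕ → ℝ} (ha : ∀ k, 0 ≤ a k)
    (hasum : Summable a) (hu : ∀ k, 0 ≤ u k) (hg : ∀ k, 0 ≤ g k)
    (hP : P = fun k => ∏ j ∈ Finset.range k, (1 + a j))
    {l : ℝ} (h : Tendsto (fun k => u k / P k + ∑ j ∈ Finset.range k, (g j - a j) / P (j + 1))
      atTop (𝓝 l)) :
    (∃ c, Tendsto u atTop (𝓝 c)) ∧ Summable g := by
  have hP1 : ∀ k, 1 ≤ P k := by
    intro k
    rw [hP]
    exact one_le_prod_one_add _ ha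
  have hP0 : ∀ k, 0 < P k := fun k => zero_lt_one.trans_le (hP1 k)
  have hPmono : Monotone P := by
    refine monotone_nat_of_le_succ fun k => ?_
    have : P (k + 1) = P k * (1 + a k) := by rw [hP]; exact Finset.prod_range_succ _ _
    rw [this]
    nlinarith [hP0 k, ha k]
  set R := Real.exp (∑' k, a k)
  have hPR : ∀ k, P k ≤ R := by
    intro k
    rw [hP]
    refine (Real.prod_one_add_le_exp_sum _ ha).trans ?_
    exact Real.exp_le_exp.2 (hasum.sum_le_tsum _ fun j _ => ha j)
  have hPlim : Tendsto P atTop (𝓝 (⨆ k, P k)) :=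
    tendsto_atTop_ciSup hPmono ⟨R, by rintro _ ⟨k, rfl⟩; exact hPR k⟩
  have haP : Summable fun j => a j / P (j + 1) := by
    refine Summable.of_nonneg_of_le (fun j => div_nonneg (ha j) (hP0 _).le) (fun j => ?_) hasum
    exact div_le_self (ha j) (hP1 _)
  have hsub : ∀ k, ∑ j ∈ Finset.range k, (g j - a j) / P (j + 1)
      = ∑ j ∈ Finset.range k, g j / P (j + 1) - ∑ j ∈ Finset.range k, a j / P (j + 1) := by
    intro k
    rw [← Finset.sum_sub_distrib]
    exact Finset.sum_congr rfl fun j _ => sub_div _ _ _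
  have hY : Tendsto (fun k => u k / P k + ∑ j ∈ Finset.range k, g j / P (j + 1)) atTop
      (𝓝 (l + ∑' j, a j / P (j + 1))) := by
    refine (h.add haP.hasSum.tendsto_sum_nat).congr fun k => ?_
    rw [hsub]
    ring
  obtain ⟨M, hM⟩ := hY.bddAbove_range
  have hgP0 : ∀ j, 0 ≤ g j / P (j + 1) := fun j => div_nonneg (hg j) (hP0 _).le
  -- Nonnegativity of `u / P` lets the bounded total control the partial sums of `g / P`.
  have hgP : Summable fun j => g j / P (j + 1) := by
    refine summable_of_sum_range_le (c := M) hgP0 fun k => ?_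
    have h1 : u k / P k + ∑ j ∈ Finset.range k, g j / P (j + 1) ≤ M := hM ⟨k, rfl⟩
    have h2 : 0 ≤ u k / P k := div_nonneg (hu k) (hP0 k).le
    linarith
  constructor
  · refine ⟨_, ((hY.sub hgP.hasSum.tendsto_sum_nat).mul hPlim).congr fun k => ?_⟩
    rw [add_sub_cancel_right, div_mul_cancel₀ _ (hP0 k).ne']
  · refine Summable.of_nonneg_of_le hg (fun j => ?_) (hgP.mul_left R)
    calc g j = P (j + 1) * (g j / P (j + 1)) := by rw [mul_div_cancel₀ _ (hP0 _).ne']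
      _ ≤ R * (g j / P (j + 1)) := by gcongr; exacts [hgP0 j, hPR _]

variable {Ω : Type*} {m0 : MeasurableSpace Ω} {μ : Measure Ω} [IsFiniteMeasure μ]
  {ℱ : Filtration ℕ m0} {U g : ℕ → Ω → ℝ} {a : ℕ → ℝ}

/-- Discounting by `P k = ∏ (1 + a j)` and compensating makes `X` a supermartingale. It is bounded
below by `-∑ a`, hence bounded in `L¹`, and Doob's theorem applies to `-X`. -/
theorem robbins_siegmund_of_integrable (ha : ∀ k, 0 ≤ a k) (hasum : Summable a)
    (hU : StronglyAdapted ℱ U) (hg : StronglyAdapted ℱ g)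
    (hU0 : ∀ k ω, 0 ≤ U k ω) (hg0 : ∀ k ω, 0 ≤ g k ω) (hint : Integrable (U 0) μ)
    (hstep : ∀ k s, MeasurableSet[ℱ k] s → ∫⁻ ω in s, ENNReal.ofReal (U (k + 1) ω + g k ω) ∂μ
      ≤ ∫⁻ ω in s, ENNReal.ofReal ((1 + a k) * U k ω + a k) ∂μ) :
    ∀ᵐ ω ∂μ, (∃ c, Tendsto (fun k => U k ω) atTop (𝓝 c)) ∧ Summable fun k => g k ω := by
  have hUm : ∀ k, StronglyMeasurable (U k) := fun k => (hU k).mono (ℱ.le k)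
  have hgm : ∀ k, StronglyMeasurable (g k) := fun k => (hg k).mono (ℱ.le k)
  have hrhs0 : ∀ k ω, 0 ≤ (1 + a k) * U k ω + a k := fun k ω =>
    add_nonneg (mul_nonneg (by linarith [ha k]) (hU0 k ω)) (ha k)
  have hlhs0 : ∀ k ω, 0 ≤ U (k + 1) ω + g k ω := fun k ω => add_nonneg (hU0 _ _) (hg0 _ _)
  have hnext : ∀ k, Integrable (U k) μ → Integrable (fun ω => U (k + 1) ω + g k ω) μ := by
    intro k hk
    refine (lintegral_ofReal_ne_top_iff_integrable
      ((hUm (k + 1)).add (hgm k)).aestronglyMeasurable (ae_of_all _ (hlhs0 k))).1 ?_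
    have h1 := hstep k Set.univ MeasurableSet.univ
    rw [Measure.restrict_univ] at h1
    refine ne_top_of_le_ne_top ?_ h1
    exact (lintegral_ofReal_ne_top_iff_integrable
      ((((hUm k).const_mul _).add stronglyMeasurable_const).aestronglyMeasurable)
      (ae_of_all _ (hrhs0 k))).2 ((hk.const_mul _).add (integrable_const _))
  have hUint : ∀ k, Integrable (U k) μ := by
    intro k
    induction k with
    | zero => exact hint
    | succ k ih =>
      refine (hnext k ih).mono' (hUm _).aestronglyMeasurable (ae_of_all _ fun ω => ?_)
      rw [Real.norm_of_nonneg (hU0 _ _)]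
      exact le_add_of_nonneg_right (hg0 _ _)
  have hgint : ∀ k, Integrable (g k) μ := by
    intro k
    refine (hnext k (hUint k)).mono' (hgm _).aestronglyMeasurable (ae_of_all _ fun ω => ?_)
    rw [Real.norm_of_nonneg (hg0 _ _)]
    exact le_add_of_nonneg_left (hU0 _ _)
  have hstep' : ∀ k s, MeasurableSet[ℱ k] s → ∫ ω in s, (U (k + 1) ω + g k ω) ∂μ
      ≤ ∫ ω in s, ((1 + a k) * U k ω + a k) ∂μ := by
    intro k s hs
    have hr : Integrable (fun ω => (1 + a k) * U k ω + a k) μ :=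
      ((hUint k).const_mul _).add (integrable_const _)
    rw [← ENNReal.ofReal_le_ofReal_iff (integral_nonneg (hrhs0 k)),
      ofReal_integral_eq_lintegral_ofReal (hnext k (hUint k)).integrableOn
        (ae_of_all _ (hlhs0 k)),
      ofReal_integral_eq_lintegral_ofReal hr.integrableOn (ae_of_all _ (hrhs0 k))]
    exact hstep k s hs
  set P : ℕ → ℝ := fun k => ∏ j ∈ Finset.range k, (1 + a j) with hP
  have hP1 : ∀ k, 1 ≤ P k := fun k => one_le_prod_one_add _ ha
  have hP0 : ∀ k, 0 < P k := fun k => zero_lt_one.trans_le (hP1 k)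
  have hPs : ∀ k, P (k + 1) = P k * (1 + a k) := fun k => Finset.prod_range_succ _ _
  set X : ℕ → Ω → ℝ := fun k ω =>
    U k ω / P k + ∑ j ∈ Finset.range k, (g j ω - a j) / P (j + 1) with hX
  have hXadp : StronglyAdapted ℱ X := by
    intro k
    refine StronglyMeasurable.add ((hU k).div stronglyMeasurable_const) ?_
    refine Finset.stronglyMeasurable_fun_sum _ fun j hj => ?_
    have hj' : j ≤ k := (Finset.mem_range.1 hj).le
    exact (((hg j).mono (ℱ.mono hj')).sub stronglyMeasurable_const).div stronglyMeasurable_const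
  have hXint : ∀ k, Integrable (X k) μ := by
    intro k
    refine ((hUint k).div_const _).add (integrable_finsetSum _ fun j _ => ?_)
    exact ((hgint j).sub (integrable_const _)).div_const _
  have hXsucc : ∀ k ω, X (k + 1) ω = X k ω
      + (P (k + 1))⁻¹ * ((U (k + 1) ω + g k ω) - ((1 + a k) * U k ω + a k)) := by
    intro k ω
    have h1 : (1 + a k) ≠ 0 := by linarith [ha k]
    have h2 := (hP0 k).ne'
    simp only [hX, Finset.sum_range_succ, hPs]
    field_simp
    ring
  have hsuper : Supermartingale X ℱ μ := by
    refine supermartingale_of_setIntegral_succ_le hXadp hXint fun k s hs => ?_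
    simp_rw [hXsucc k]
    have hr : Integrable (fun ω => (1 + a k) * U k ω + a k) μ :=
      ((hUint k).const_mul _).add (integrable_const _)
    have hd : Integrable (fun ω => (P (k + 1))⁻¹ *
        ((U (k + 1) ω + g k ω) - ((1 + a k) * U k ω + a k))) μ :=
      ((hnext k (hUint k)).sub hr).const_mul _
    rw [integral_add (hXint k).integrableOn hd.integrableOn, integral_const_mul,
      integral_sub (hnext k (hUint k)).integrableOn hr.integrableOn]
    have h1 := hstep' k s hs
    have h2 : 0 ≤ (P (k + 1))⁻¹ := (inv_pos.2 (hP0 _)).le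
    nlinarith
  set T := ∑' j, a j
  have hlow : ∀ k ω, -T ≤ X k ω := by
    intro k ω
    have h1 : 0 ≤ U k ω / P k := div_nonneg (hU0 _ _) (hP0 _).le
    have h2 : ∑ j ∈ Finset.range k, -a j ≤ ∑ j ∈ Finset.range k, (g j ω - a j) / P (j + 1) := by
      refine Finset.sum_le_sum fun j _ => ?_
      have h3 : a j / P (j + 1) ≤ a j := div_le_self (ha j) (hP1 _)
      have h4 : 0 ≤ g j ω / P (j + 1) := div_nonneg (hg0 _ _) (hP0 _).le
      rw [sub_div]
      linarith
    have h5 := hasum.sum_le_tsum (Finset.range k) fun j _ => ha j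
    rw [Finset.sum_neg_distrib] at h2
    simp only [hX]
    linarith
  have hT : 0 ≤ T := tsum_nonneg ha
  have hbdd : ∀ k, eLpNorm ((-X) k) 1 μ
      ≤ ((∫ ω, X 0 ω ∂μ + 2 * T * μ.real Set.univ).toNNReal : ℝ≥0) := by
    intro k
    -- From `X ≥ -T` follows `|X| ≤ X + 2T`.
    have h1 : ∫ ω, ‖X k ω‖ ∂μ ≤ ∫ ω, X 0 ω ∂μ + 2 * T * μ.real Set.univ := by
      calc ∫ ω, ‖X k ω‖ ∂μ ≤ ∫ ω, (X k ω + 2 * T) ∂μ := by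
            refine integral_mono (hXint k).norm ((hXint k).add (integrable_const _)) fun ω => ?_
            have := hlow k ω
            rw [Real.norm_eq_abs]
            exact abs_le.2 ⟨by linarith, by linarith⟩
        _ = ∫ ω, X k ω ∂μ + 2 * T * μ.real Set.univ := by
            rw [integral_add (hXint k) (integrable_const _), integral_const, smul_eq_mul]
            ring
        _ ≤ _ := by
            have := hsuper.setIntegral_le (Nat.zero_le k) (s := Set.univ) MeasurableSet.univ
            simp only [Measure.restrict_univ] at this
            linarith
    rw [Pi.neg_apply, eLpNorm_neg, eLpNorm_one_eq_lintegral_enorm,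
      ← ofReal_integral_norm_eq_lintegral_enorm (hXint k)]
    exact ENNReal.ofReal_le_ofReal h1
  filter_upwards [hsuper.neg.exists_ae_tendsto_of_bdd hbdd] with ω hω
  obtain ⟨l, hl⟩ := hω
  refine tendsto_and_summable_of_discounted (l := -l) ha hasum (fun k => hU0 k ω)
    (fun k => hg0 k ω) hP ?_
  refine hl.neg.congr fun k => ?_
  simp [hX]

/-- **Robbins-Siegmund**: almost supermartingales converge. The almost supermartingale property
need only be tested on events where the process is bounded, and no integrability is assumed. -/
theorem robbins_siegmund (ha : ∀ k, 0 ≤ a k) (hasum : Summable a)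
    (hU : StronglyAdapted ℱ U) (hg : StronglyAdapted ℱ g)
    (hU0 : ∀ k ω, 0 ≤ U k ω) (hg0 : ∀ k ω, 0 ≤ g k ω)
    (hstep : ∀ k s (M : ℝ), MeasurableSet[ℱ k] s → (∀ ω ∈ s, U k ω ≤ M) →
      ∫⁻ ω in s, ENNReal.ofReal (U (k + 1) ω + g k ω) ∂μ
        ≤ ∫⁻ ω in s, ENNReal.ofReal ((1 + a k) * U k ω + a k) ∂μ) :
    ∀ᵐ ω ∂μ, (∃ c, Tendsto (fun k => U k ω) atTop (𝓝 c)) ∧ Summable fun k => g k ω := by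
  have hlevel : ∀ k (M : ℝ), MeasurableSet[ℱ k] {ω | U k ω ≤ M} := fun k M =>
    (hU k).measurable measurableSet_Iic
  have hstep' : ∀ k s, MeasurableSet[ℱ k] s →
      ∫⁻ ω in s, ENNReal.ofReal (U (k + 1) ω + g k ω) ∂μ
        ≤ ∫⁻ ω in s, ENNReal.ofReal ((1 + a k) * U k ω + a k) ∂μ := by
    intro k s hs
    -- Monotone convergence along the level sets of `U k` removes the boundedness restriction.
    have hunion : s = ⋃ M : ℕ, s ∩ {ω | U k ω ≤ M} := by
      rw [← Set.inter_iUnion, Set.inter_eq_left.2]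
      intro ω _
      obtain ⟨M, hM⟩ := exists_nat_ge (U k ω)
      exact Set.mem_iUnion.2 ⟨M, hM⟩
    have hdir : Directed (· ⊆ ·) fun M : ℕ => s ∩ {ω | U k ω ≤ M} := by
      refine Monotone.directed_le fun M M' hMM' ω hω => ⟨hω.1, ?_⟩
      exact le_trans (show U k ω ≤ M from hω.2) (by exact_mod_cast hMM')
    conv_lhs => rw [hunion]
    rw [setLIntegral_iUnion_of_directed _ hdir]
    refine iSup_le fun M => ?_
    exact (hstep k _ M (hs.inter (hlevel k M)) fun ω hω => hω.2).trans
      (lintegral_mono_set Set.inter_subset_left)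
  -- The event `U 0 ≤ N` lies in every `ℱ k`, so restricting `μ` to it preserves the inequality and
  -- makes `U 0` integrable. These events cover `Ω`.
  have hloc : ∀ N : ℕ, ∀ᵐ ω ∂μ.restrict {ω | U 0 ω ≤ N},
      (∃ c, Tendsto (fun k => U k ω) atTop (𝓝 c)) ∧ Summable fun k => g k ω := by
    intro N
    have hm0 : MeasurableSet {ω | U 0 ω ≤ N} := ℱ.le 0 _ (hlevel 0 N)
    refine robbins_siegmund_of_integrable ha hasum hU hg hU0 hg0 ?_ fun k s hs => ?_
    · refine Integrable.of_bound ((hU 0).mono (ℱ.le 0)).aestronglyMeasurable (N : ℝ) ?_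
      refine (ae_restrict_iff' hm0).2 (ae_of_all _ fun ω hω => ?_)
      rw [Real.norm_of_nonneg (hU0 _ _)]
      exact hω
    · rw [Measure.restrict_restrict (ℱ.le k _ hs)]
      exact hstep' k _ (hs.inter (ℱ.mono (Nat.zero_le k) _ (hlevel 0 N)))
  have hall : ∀ᵐ ω ∂μ, ∀ N : ℕ, U 0 ω ≤ N →
      (∃ c, Tendsto (fun k => U k ω) atTop (𝓝 c)) ∧ Summable fun k => g k ω := by
    rw [ae_all_iff]
    exact fun N => (ae_restrict_iff' (ℱ.le 0 _ (hlevel 0 N))).1 (hloc N)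
  filter_upwards [hall] with ω hω
  obtain ⟨N, hN⟩ := exists_nat_ge (U 0 ω)
  exact hω N hN

end Probability

end SPS

namespace SPS

/-! ### Second moments and measurability of the iterates -/

theorem integrableOn_norm_sq_and_setIntegral_le_of_condLExp_le {Ω E : Type*}
    [NormedAddCommGroup E] {m m0 : MeasurableSpace Ω} {μ : Measure Ω} [IsFiniteMeasure μ]
    (hm : m ≤ m0) {f : Ω → E} (hf : AEStronglyMeasurable f μ) {b : Ω → ℝ} (hb0 : ∀ ω, 0 ≤ b ω)
    (h : ∀ᵐ ω ∂μ, condLExp m μ (fun ω' => ‖f ω'‖ₑ ^ 2) ω ≤ ENNReal.ofReal (b ω))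
    {s : Set Ω} (hs : MeasurableSet[m] s) (hb : IntegrableOn b s μ) :
    IntegrableOn (fun ω => ‖f ω‖ ^ 2) s μ ∧ ∫ ω in s, ‖f ω‖ ^ 2 ∂μ ≤ ∫ ω in s, b ω ∂μ := by
  have h1 := lintegral_enorm_sq_le_of_condLExp_le hm h hs
  have h2 : ∀ ω, ‖f ω‖ₑ ^ 2 = ENNReal.ofReal (‖f ω‖ ^ 2) := fun ω => by
    rw [← ofReal_norm, ENNReal.ofReal_pow (norm_nonneg _)]
  simp_rw [h2] at h1
  rw [← ofReal_integral_eq_lintegral_ofReal hb (ae_of_all _ hb0)] at h1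
  have hint : IntegrableOn (fun ω => ‖f ω‖ ^ 2) s μ :=
    (lintegral_ofReal_ne_top_iff_integrable (hf.norm.pow 2).restrict
      (ae_of_all _ fun ω => sq_nonneg _)).1 (ne_top_of_le_ne_top ENNReal.ofReal_ne_top h1)
  refine ⟨hint, ?_⟩
  rwa [← ofReal_integral_eq_lintegral_ofReal hint (ae_of_all _ fun ω => sq_nonneg _),
    ENNReal.ofReal_le_ofReal_iff (integral_nonneg hb0)] at h1

section Iterates

variable {d n : ℕ} {Ω : Type*} {A : Fin n → Vec d → Set (Vec d)} {B : Vec d → Vec d} {τ : ℝ}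
  {α ρ : ℕ → ℝ} {ε e z : ℕ → Ω → Vec d} {w x y : ℕ → Ω → Fin (n + 1) → Vec d}

/-- The σ-algebra `m` is arbitrary: with the ambient one this makes the iterates measurable, with
`pastSigma` it makes the residual adapted. -/
theorem measurable_resolvent_block {m : MeasurableSpace Ω} (hA : ∀ i, IsMonotoneOp (A i))
    (hτ : 0 < τ)
    (hrun : ∀ ω, IsRun A B τ α ρ (fun k => ε k ω) (fun k => e k ω)
      (fun k => z k ω) (fun k => w k ω) (fun k => x k ω) (fun k => y k ω))
    {k : ℕ} (hz : Measurable (z k)) (hw : Measurable (w k)) (i : Fin n) :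
    Measurable (fun ω => x k ω i.castSucc) ∧ Measurable (fun ω => y k ω i.castSucc) := by
  obtain ⟨J, hJ, hJx⟩ := (hA i).exists_continuous_resolvent hτ
  have ht : Measurable fun ω => z k ω + τ • w k ω i.castSucc :=
    hz.add ((measurable_pi_iff.1 hw _).fun_const_smul τ)
  have hx : (fun ω => x k ω i.castSucc) = fun ω => J (z k ω + τ • w k ω i.castSucc) :=
    funext fun ω => hJx _ _ ((hrun ω).x_resolvent k i)
  have hy : (fun ω => y k ω i.castSucc)
      = fun ω => τ⁻¹ • ((z k ω + τ • w k ω i.castSucc) - x k ω i.castSucc) :=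
    funext fun ω => (hrun ω).y_resolvent k i
  have hxm : Measurable fun ω => x k ω i.castSucc := by
    rw [hx]
    exact hJ.measurable.comp ht
  refine ⟨hxm, ?_⟩
  rw [hy]
  exact (ht.sub hxm).fun_const_smul _

theorem measurable_pastSigma (z : ℕ → Ω → Vec d) (w : ℕ → Ω → Fin (n + 1) → Vec d) (k : ℕ) :
    Measurable[pastSigma z w k] (z k) ∧ Measurable[pastSigma z w k] (w k) := by
  have h : Measurable[pastSigma z w k] fun ω => (z k ω, w k ω) :=
    (comap_measurable _).mono (le_iSup₂_of_le k le_rfl le_rfl) le_rfl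
  exact ⟨measurable_fst.comp h, measurable_snd.comp h⟩

variable [m0 : MeasurableSpace Ω]

theorem measurable_last_block (hB : Continuous B)
    (hrun : ∀ ω, IsRun A B τ α ρ (fun k => ε k ω) (fun k => e k ω)
      (fun k => z k ω) (fun k => w k ω) (fun k => x k ω) (fun k => y k ω))
    (hεmeas : ∀ k, Measurable (ε k)) (hemeas : ∀ k, Measurable (e k))
    {k : ℕ} (hz : Measurable (z k)) (hw : Measurable (w k)) :
    Measurable (fun ω => x k ω (Fin.last n)) ∧ Measurable (fun ω => y k ω (Fin.last n)) := by
  have hx : (fun ω => x k ω (Fin.last n))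
      = fun ω => z k ω - ρ k • ((B (z k ω) + ε k ω) - w k ω (Fin.last n)) :=
    funext fun ω => (hrun ω).x_last k
  have hy : (fun ω => y k ω (Fin.last n)) = fun ω => B (x k ω (Fin.last n)) + e k ω :=
    funext fun ω => (hrun ω).y_last k
  have hxm : Measurable fun ω => x k ω (Fin.last n) := by
    rw [hx]
    exact hz.sub ((((hB.measurable.comp hz).add (hεmeas k)).sub
      (measurable_pi_iff.1 hw _)).fun_const_smul _)
  refine ⟨hxm, ?_⟩
  rw [hy]
  exact (hB.measurable.comp hxm).add (hemeas k)

theorem measurable_iterates (hA : ∀ i, IsMonotoneOp (A i)) (hB : Continuous B) (hτ : 0 < τ)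
    (hrun : ∀ ω, IsRun A B τ α ρ (fun k => ε k ω) (fun k => e k ω)
      (fun k => z k ω) (fun k => w k ω) (fun k => x k ω) (fun k => y k ω))
    (hz0 : Measurable (z 0)) (hw0 : Measurable (w 0))
    (hεmeas : ∀ k, Measurable (ε k)) (hemeas : ∀ k, Measurable (e k)) (k : ℕ) :
    Measurable (z k) ∧ Measurable (w k) := by
  induction k with
  | zero => exact ⟨hz0, hw0⟩
  | succ k ih =>
    obtain ⟨hz, hw⟩ := ih
    have hlast := measurable_last_block hB hrun hεmeas hemeas hz hw
    have hblock := measurable_resolvent_block hA hτ hrun hz hw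
    have hx : ∀ i, Measurable fun ω => x k ω i :=
      Fin.lastCases hlast.1 fun i => (hblock i).1
    have hy : ∀ i, Measurable fun ω => y k ω i :=
      Fin.lastCases hlast.2 fun i => (hblock i).2
    have hz' : z (k + 1) = fun ω => z k ω - α k • ∑ i, y k ω i :=
      funext fun ω => (hrun ω).z_succ k
    have hw' : ∀ i, (fun ω => w (k + 1) ω i)
        = fun ω => w k ω i - α k • (x k ω i - ((n : ℝ) + 1)⁻¹ • ∑ j, x k ω j) :=
      fun i => funext fun ω => (hrun ω).w_succ k i
    constructor
    · rw [hz']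
      exact hz.sub ((Finset.measurable_fun_sum _ fun i _ => hy i).fun_const_smul _)
    · refine measurable_pi_iff.2 fun i => ?_
      rw [hw' i]
      exact (measurable_pi_iff.1 hw i).sub
        (((hx i).sub ((Finset.measurable_fun_sum _ fun j _ => hx j).fun_const_smul _)).fun_const_smul _)

/-- The filtration generated by the primal-dual iterates. -/
def pastFiltration (hz : ∀ k, Measurable (z k)) (hw : ∀ k, Measurable (w k)) :
    Filtration ℕ m0 where
  seq := pastSigma z w
  mono' _ _ hkl := iSup₂_le fun j hj => le_iSup₂_of_le j (hj.trans hkl) le_rfl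
  le' _ := iSup₂_le fun j _ => ((hz j).prodMk (hw j)).comap_le

end Iterates

theorem measurable_sqDist {d m : ℕ} {Ω : Type*} {mΩ : MeasurableSpace Ω} {z : Ω → Vec d}
    {w : Ω → Fin m → Vec d} (hz : Measurable z) (hw : Measurable w) (q : Vec d × (Fin m → Vec d)) :
    Measurable fun ω => sqDist (z ω, w ω) q := by
  have h1 : Measurable fun ω => ‖z ω - q.1‖ ^ 2 := (hz.sub_const _).norm.pow_const 2
  have h2 : ∀ i, Measurable fun ω => ‖w ω i - q.2 i‖ ^ 2 := fun i =>
    ((measurable_pi_iff.1 hw i).sub_const _).norm.pow_const 2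
  exact h1.add (Finset.measurable_fun_sum _ fun i _ => h2 i)

theorem measurable_residual {d n : ℕ} {Ω : Type*} {mΩ : MeasurableSpace Ω} {B : Vec d → Vec d}
    (hB : Continuous B) {z : Ω → Vec d} {w y : Ω → Fin (n + 1) → Vec d} (hz : Measurable z)
    (hw : Measurable w) (hy : ∀ i : Fin n, Measurable fun ω => y ω i.castSucc) :
    Measurable fun ω => residual B (z ω) (w ω) (y ω) := by
  have h1 : ∀ i : Fin n, Measurable fun ω => ‖y ω i.castSucc - w ω i.castSucc‖ ^ 2 := fun i =>
    ((hy i).sub (measurable_pi_iff.1 hw _)).norm.pow_const 2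
  have h2 : Measurable fun ω => ‖B (z ω) - w ω (Fin.last n)‖ ^ 2 :=
    ((hB.measurable.comp hz).sub (measurable_pi_iff.1 hw _)).norm.pow_const 2
  exact (Finset.measurable_fun_sum _ fun i _ => h1 i).add h2

theorem norm_sq_le_of_lipschitz {d : ℕ} {B : Vec d → Vec d} {L : ℝ≥0} (hBlip : LipschitzWith L B)
    (u v : Vec d) : ‖B u‖ ^ 2 ≤ 2 * ‖B v‖ ^ 2 + 2 * L ^ 2 * ‖u - v‖ ^ 2 := by
  have h1 := norm_sub_sq_le_two_mul (B u) (B v) 0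
  have h2 : ‖B u - B v‖ ^ 2 ≤ (L * ‖u - v‖) ^ 2 := by
    gcongr
    exact hBlip.norm_sub_le u v
  rw [sub_zero, sub_zero] at h1
  rw [mul_pow] at h2
  linarith

end SPS

namespace SPS

/-! ### The almost supermartingale inequality -/

set_option maxHeartbeats 1000000 in
/-- The iterates of stochastic projective splitting are an almost supermartingale relative to each
point of the extended solution set. -/
theorem ae_tendsto_sqDist_and_summable_residual {d n : ℕ} {Ω : Type*} [m0 : MeasurableSpace Ω]
    {μ : Measure Ω} [IsProbabilityMeasure μ]
    {A : Fin n → Vec d → Set (Vec d)} {B : Vec d → Vec d} {L : ℝ≥0}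
    (hA : ∀ i, IsMonotoneOp (A i))
    (hBmono : ∀ u v : Vec d, 0 ≤ inner ℝ (B u - B v) (u - v)) (hBlip : LipschitzWith L B)
    {τ : ℝ} (hτ : 0 < τ) {α ρ : ℕ → ℝ} (hα : ∀ k, 0 ≤ α k) (hρ : ∀ k, 0 ≤ ρ k)
    (hα2 : Summable fun k => α k ^ 2) (hαρ2 : Summable fun k => α k * ρ k ^ 2)
    {ρbar : ℝ} (hρbar : ∀ k, ρ k ≤ ρbar) (hρbarL : ρbar * (L : ℝ) < 1)
    {ε e z : ℕ → Ω → Vec d} {w x y : ℕ → Ω → Fin (n + 1) → Vec d}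
    (hz0 : Measurable (z 0)) (hw0 : Measurable (w 0))
    (hεmeas : ∀ k, Measurable (ε k)) (hemeas : ∀ k, Measurable (e k))
    (hrun : ∀ ω, IsRun A B τ α ρ (fun k => ε k ω) (fun k => e k ω)
      (fun k => z k ω) (fun k => w k ω) (fun k => x k ω) (fun k => y k ω))
    (hεint : ∀ k, Integrable (ε k) μ) (heint : ∀ k, Integrable (e k) μ)
    (hεmean : ∀ k, μ[ε k | pastSigma z w k] =ᵐ[μ] 0)
    (hemean : ∀ k, μ[e k | pastSigma z w k] =ᵐ[μ] 0)
    {N₁ N₂ N₃ N₄ : ℝ} (hN₁ : 0 ≤ N₁) (hN₂ : 0 ≤ N₂) (hN₃ : 0 ≤ N₃) (hN₄ : 0 ≤ N₄)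
    (hεvar : ∀ k, ∀ᵐ ω ∂μ,
      condLExp (pastSigma z w k) μ (fun ω' => ‖ε k ω'‖ₑ ^ 2) ω
        ≤ ENNReal.ofReal (N₁ + N₂ * ‖B (z k ω)‖ ^ 2))
    (hevar : ∀ k, ∀ᵐ ω ∂μ,
      condLExp (pastSigma z w k ⊔ noiseSigma (ε k)) μ (fun ω' => ‖e k ω'‖ₑ ^ 2) ω
        ≤ ENNReal.ofReal (N₃ + N₄ * ‖B (x k ω (Fin.last n))‖ ^ 2))
    {q : Vec d × (Fin (n + 1) → Vec d)} (hq : q ∈ extendedSolutionSet A B) :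
    ∀ᵐ ω ∂μ, (∃ c, Tendsto (fun k => sqDist (z k ω, w k ω) q) atTop (𝓝 c)) ∧
      Summable fun k => (α k * ρ k) * residual B (z k ω) (w k ω) (y k ω) := by
  have hρbar0 : 0 ≤ ρbar := (hρ 0).trans (hρbar 0)
  have hBc : Continuous B := hBlip.continuous
  have hmeas := measurable_iterates hA hBc hτ hrun hz0 hw0 hεmeas hemeas
  have hzm : ∀ k, Measurable (z k) := fun k => (hmeas k).1
  have hwm : ∀ k, Measurable (w k) := fun k => (hmeas k).2
  have hxm : ∀ k, Measurable fun ω => x k ω (Fin.last n) := fun k =>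
    (measurable_last_block hBc hrun hεmeas hemeas (hzm k) (hwm k)).1
  obtain ⟨c, hc, hcτ, hcL⟩ : ∃ c : ℝ, 0 < c ∧ c * ρbar ≤ τ ∧ c ≤ 1 - ρbar * L := by
    -- The denominator `ρbar + 1` covers the case `ρbar = 0`.
    refine ⟨min (τ / (ρbar + 1)) (1 - ρbar * L),
      lt_min (by positivity) (by linarith), ?_, min_le_right _ _⟩
    calc min (τ / (ρbar + 1)) (1 - ρbar * L) * ρbar ≤ τ / (ρbar + 1) * (ρbar + 1) := by
          have : 0 ≤ τ / (ρbar + 1) := by positivity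
          exact mul_le_mul (min_le_left _ _) (by linarith) hρbar0 this
      _ = τ := div_mul_cancel₀ _ (by positivity)
  obtain ⟨C, hC, hstep⟩ := exists_one_step_bound A hA hBlip hBmono hτ ρbar hc.le hcτ hcL hq
  set C₁ : ℝ := 3 * ((1 + ρbar * L) ^ 2 + ρbar ^ 2)
  have hC₁ : 0 ≤ C₁ := by positivity
  set b₀ : ℝ := 2 * ‖B q.1‖ ^ 2
  have hb₀ : 0 ≤ b₀ := by positivity
  set ℓ : ℝ := 2 * (L : ℝ) ^ 2
  have hℓ : 0 ≤ ℓ := by positivity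
  -- With `V` the distance to `q`, the second moments of `ε` and `e` integrate to at most `D₁` and
  -- `D₂` times the integral of `1 + V`. The factor `1 + D₁` in `D₂` appears because `x_{n+1}`
  -- contains `ε`; `K` collects the coefficients of `α ρ²` and `α²`.
  set D₁ : ℝ := N₁ + N₂ * (b₀ + ℓ)
  have hD₁ : 0 ≤ D₁ := by positivity
  set D₂ : ℝ := N₃ + N₄ * (b₀ + ℓ * C₁ * (1 + D₁))
  have hD₂ : 0 ≤ D₂ := by positivity
  set K : ℝ := 2 * L * D₁ + C * (1 + D₁ + D₂)
  have hK : 0 ≤ K := by positivity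
  have key := robbins_siegmund (μ := μ) (ℱ := pastFiltration hzm hwm)
    (U := fun k ω => sqDist (z k ω, w k ω) q)
    (g := fun k ω => 2 * c * (α k * ρ k) * residual B (z k ω) (w k ω) (y k ω))
    (a := fun k => K * (α k * ρ k ^ 2 + α k ^ 2))
    (fun k => mul_nonneg hK (add_nonneg (mul_nonneg (hα k) (sq_nonneg _)) (sq_nonneg _)))
    ((hαρ2.add hα2).mul_left K)
    (fun k => (measurable_sqDist (measurable_pastSigma z w k).1
      (measurable_pastSigma z w k).2 q).stronglyMeasurable)
    (fun k => ((measurable_residual hBc (measurable_pastSigma z w k).1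
      (measurable_pastSigma z w k).2 fun i => (measurable_resolvent_block hA hτ hrun
        (measurable_pastSigma z w k).1 (measurable_pastSigma z w k).2 i).2).const_mul
          _).stronglyMeasurable)
    (fun k ω => sqDist_nonneg (_, _) q)
    (fun k ω => mul_nonneg (mul_nonneg (by linarith) (mul_nonneg (hα k) (hρ k)))
      (residual_nonneg _ _ _ _)) ?_
  · filter_upwards [key] with ω hω
    refine ⟨hω.1, ?_⟩
    have h2c : 2 * c ≠ 0 := by positivity
    refine (hω.2.mul_left (2 * c)⁻¹).congr fun k => ?_
    field_simp
  · intro k s M hs hM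
    have hle : pastSigma z w k ≤ m0 := (pastFiltration hzm hwm).le k
    have hs' : MeasurableSet[pastSigma z w k] s := hs
    have hsm : MeasurableSet s := hle _ hs'
    obtain ⟨hzp, hwp⟩ := measurable_pastSigma z w k
    have hwlast : Measurable[pastSigma z w k] fun ω => w k ω (Fin.last n) :=
      (measurable_pi_apply (Fin.last n)).comp hwp
    set V : Ω → ℝ := fun ω => sqDist (z k ω, w k ω) q
    have hMV : ∀ ω ∈ s, V ω ≤ M := hM
    have hV0 : ∀ ω, 0 ≤ V ω := fun ω => sqDist_nonneg (_, _) q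
    have hVz : ∀ ω, ‖z k ω - q.1‖ ^ 2 ≤ V ω := fun ω =>
      norm_fst_sub_sq_le_sqDist (z k ω, w k ω) q
    have hVw : ∀ ω, ‖w k ω (Fin.last n) - q.2 (Fin.last n)‖ ^ 2 ≤ V ω := fun ω =>
      norm_snd_sub_sq_le_sqDist (z k ω, w k ω) q (Fin.last n)
    have hVm : Measurable V := measurable_sqDist (hzm k) (hwm k) q
    have hVint : IntegrableOn V s μ := by
      refine Integrable.of_bound hVm.aestronglyMeasurable M ?_
      refine (ae_restrict_iff' hsm).2 (ae_of_all _ fun ω hω => ?_)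
      rw [Real.norm_of_nonneg (hV0 ω)]
      exact hMV ω hω
    have hone : IntegrableOn (fun _ : Ω => (1 : ℝ)) s μ := integrable_const _
    have hJint : IntegrableOn (fun ω => 1 + V ω) s μ := hone.add hVint
    -- cross terms
    obtain ⟨hX1, hX1'⟩ := integrableOn_inner_and_setIntegral_inner_eq_zero hle
      (f := fun ω => z k ω - q.1) (hzp.sub_const _).stronglyMeasurable (heint k) (hemean k) hs'
      (M := √M) fun ω hω => Real.le_sqrt_of_sq_le ((hVz ω).trans (hMV ω hω))
    have hBw : ∀ ω, ‖B (z k ω) - w k ω (Fin.last n)‖ ^ 2 ≤ (ℓ + 2) * V ω := by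
      intro ω
      have h1 := norm_sub_sq_le_two_mul (B (z k ω)) (B q.1) (w k ω (Fin.last n))
      have h2 : ‖B (z k ω) - B q.1‖ ^ 2 ≤ (L * ‖z k ω - q.1‖) ^ 2 := by
        gcongr
        exact hBlip.norm_sub_le _ _
      have h3 := hVw ω
      rw [norm_sub_rev, hq.2.1] at h3
      have h4 : (L : ℝ) ^ 2 * ‖z k ω - q.1‖ ^ 2 ≤ L ^ 2 * V ω := by gcongr; exact hVz ω
      rw [mul_pow] at h2
      simp only [ℓ]
      linarith
    obtain ⟨hX2, hX2'⟩ := integrableOn_inner_and_setIntegral_inner_eq_zero hle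
      (f := fun ω => B (z k ω) - w k ω (Fin.last n))
      ((hBc.measurable.comp hzp).sub hwlast).stronglyMeasurable
      (hεint k) (hεmean k) hs' (M := √((ℓ + 2) * M)) fun ω hω =>
        Real.le_sqrt_of_sq_le ((hBw ω).trans
          (mul_le_mul_of_nonneg_left (hMV ω hω) (by linarith)))
    -- second moments
    have hBz : ∀ ω, N₁ + N₂ * ‖B (z k ω)‖ ^ 2 ≤ D₁ * (1 + V ω) := by
      intro ω
      have h1 := norm_sq_le_of_lipschitz hBlip (z k ω) q.1
      have h2 : ‖B (z k ω)‖ ^ 2 ≤ (b₀ + ℓ) * (1 + V ω) := by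
        have h3 : ℓ * ‖z k ω - q.1‖ ^ 2 ≤ ℓ * V ω := by gcongr; exact hVz ω
        have h4 : 0 ≤ b₀ * V ω := mul_nonneg hb₀ (hV0 ω)
        simp only [ℓ, b₀] at h3 h4 ⊢
        nlinarith
      have h3 := mul_le_mul_of_nonneg_left h2 hN₂
      have h4 := mul_nonneg hN₁ (hV0 ω)
      simp only [D₁]
      linarith
    have hbε0 : ∀ ω, 0 ≤ N₁ + N₂ * ‖B (z k ω)‖ ^ 2 := fun ω => by positivity
    have hbεint : IntegrableOn (fun ω => N₁ + N₂ * ‖B (z k ω)‖ ^ 2) s μ := by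
      refine (hJint.const_mul D₁).mono' ?_ (ae_of_all _ fun ω => ?_)
      · exact (((hBc.measurable.comp (hzm k)).norm.pow_const 2).const_mul
          N₂).const_add N₁ |>.aestronglyMeasurable
      · rw [Real.norm_of_nonneg (hbε0 ω)]
        exact hBz ω
    obtain ⟨hεI, hεI'⟩ := integrableOn_norm_sq_and_setIntegral_le_of_condLExp_le hle
      (hεmeas k).aestronglyMeasurable hbε0 (hεvar k) hs' hbεint
    have hεJ : ∫ ω in s, ‖ε k ω‖ ^ 2 ∂μ ≤ D₁ * ∫ ω in s, (1 + V ω) ∂μ := by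
      rw [← integral_const_mul]
      exact hεI'.trans (integral_mono hbεint (hJint.const_mul D₁) hBz)
    have hBx : ∀ ω, N₃ + N₄ * ‖B (x k ω (Fin.last n))‖ ^ 2
        ≤ (N₃ + N₄ * b₀) + N₄ * ℓ * C₁ * (V ω + ‖ε k ω‖ ^ 2) := by
      intro ω
      have h1 := norm_sq_le_of_lipschitz hBlip (x k ω (Fin.last n)) q.1
      have h2 : ‖x k ω (Fin.last n) - q.1‖ ^ 2 ≤ C₁ * (V ω + ‖ε k ω‖ ^ 2) :=
        (hrun ω).x_last_upper_bound hBlip hρ hρbar hq k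
      have h3 := mul_le_mul_of_nonneg_left h2 hℓ
      have h4 : ‖B (x k ω (Fin.last n))‖ ^ 2 ≤ b₀ + ℓ * (C₁ * (V ω + ‖ε k ω‖ ^ 2)) :=
        h1.trans (by gcongr)
      have h5 := mul_le_mul_of_nonneg_left h4 hN₄
      linarith
    have hbe0 : ∀ ω, 0 ≤ N₃ + N₄ * ‖B (x k ω (Fin.last n))‖ ^ 2 := fun ω => by positivity
    have hQ1 : IntegrableOn (fun ω => V ω + ‖ε k ω‖ ^ 2) s μ := hVint.add hεI
    have hdom : IntegrableOn (fun ω => (N₃ + N₄ * b₀) + N₄ * ℓ * C₁ * (V ω + ‖ε k ω‖ ^ 2)) s μ :=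
      Integrable.add (integrable_const _) (hQ1.const_mul _)
    have hbeint : IntegrableOn (fun ω => N₃ + N₄ * ‖B (x k ω (Fin.last n))‖ ^ 2) s μ := by
      refine hdom.mono' ?_ (ae_of_all _ fun ω => ?_)
      · exact (((hBc.measurable.comp (hxm k)).norm.pow_const 2).const_mul
          N₄).const_add N₃ |>.aestronglyMeasurable
      · rw [Real.norm_of_nonneg (hbe0 ω)]
        exact hBx ω
    have hle' : pastSigma z w k ⊔ noiseSigma (ε k) ≤ m0 := sup_le hle (hεmeas k).comap_le
    -- The event `s` also lies in the larger σ-algebra containing `ε`. The resulting bound involves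
    -- `x_{n+1}`, hence `‖ε‖²`, whose integral over `s` is already controlled.
    obtain ⟨heI, heI'⟩ := integrableOn_norm_sq_and_setIntegral_le_of_condLExp_le hle'
      (hemeas k).aestronglyMeasurable hbe0 (hevar k)
      ((le_sup_left : pastSigma z w k ≤ pastSigma z w k ⊔ noiseSigma (ε k)) _ hs') hbeint
    set J : ℝ := ∫ ω in s, (1 + V ω) ∂μ
    have hJeq : J = ∫ _ω in s, (1 : ℝ) ∂μ + ∫ ω in s, V ω ∂μ := integral_add hone hVint
    have h10 : 0 ≤ ∫ _ω in s, (1 : ℝ) ∂μ := integral_nonneg fun _ => zero_le_one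
    have hV10 : 0 ≤ ∫ ω in s, V ω ∂μ := integral_nonneg hV0
    have heJ : ∫ ω in s, ‖e k ω‖ ^ 2 ∂μ ≤ D₂ * J := by
      have h1 := heI'.trans (integral_mono hbeint hdom hBx)
      have h2 : ∫ ω in s, ((N₃ + N₄ * b₀) + N₄ * ℓ * C₁ * (V ω + ‖ε k ω‖ ^ 2)) ∂μ
          = (N₃ + N₄ * b₀) * ∫ _ω in s, (1 : ℝ) ∂μ
            + N₄ * ℓ * C₁ * (∫ ω in s, V ω ∂μ + ∫ ω in s, ‖ε k ω‖ ^ 2 ∂μ) := by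
        rw [integral_add (integrable_const _) (hQ1.const_mul _), integral_const_mul,
          integral_add hVint hεI, ← integral_const_mul]
        simp only [mul_one]
      have h3 : N₄ * ℓ * C₁ * (∫ ω in s, V ω ∂μ + ∫ ω in s, ‖ε k ω‖ ^ 2 ∂μ)
          ≤ N₄ * ℓ * C₁ * (J + D₁ * J) := by
        gcongr
        linarith
      have h4 : (N₃ + N₄ * b₀) * ∫ _ω in s, (1 : ℝ) ∂μ ≤ (N₃ + N₄ * b₀) * J := by
        gcongr
        linarith
      simp only [D₂]
      linarith
    -- the integrated one-step bound
    set β₁ : ℝ := 2 * α k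
    set β₂ : ℝ := 2 * α k * (ρ k - 2 * L * ρ k ^ 2)
    set β₃ : ℝ := 2 * L * (α k * ρ k ^ 2)
    have hβ₃ : 0 ≤ β₃ := mul_nonneg (by positivity) (mul_nonneg (hα k) (sq_nonneg _))
    set β₄ : ℝ := C * α k ^ 2
    have hβ₄ : 0 ≤ β₄ := by positivity
    set R : Ω → ℝ := fun ω => V ω - β₁ * inner ℝ (z k ω - q.1) (e k ω)
      - β₂ * inner ℝ (B (z k ω) - w k ω (Fin.last n)) (ε k ω) + β₃ * ‖ε k ω‖ ^ 2
      + β₄ * (V ω + ‖ε k ω‖ ^ 2 + ‖e k ω‖ ^ 2) with hR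
    set lhs : Ω → ℝ := fun ω => sqDist (z (k + 1) ω, w (k + 1) ω) q
      + 2 * c * (α k * ρ k) * residual B (z k ω) (w k ω) (y k ω)
    have hlhsR : ∀ ω, lhs ω ≤ R ω := fun ω => hstep (hrun ω) hα hρ hρbar k
    have hlhs0 : ∀ ω, 0 ≤ lhs ω := fun ω => add_nonneg (sqDist_nonneg (_, _) q)
      (mul_nonneg (mul_nonneg (by linarith) (mul_nonneg (hα k) (hρ k))) (residual_nonneg _ _ _ _))
    have hlhsm : Measurable lhs :=
      (measurable_sqDist (hzm (k + 1)) (hwm (k + 1)) q).add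
        ((measurable_residual hBc (hzm k) (hwm k) fun i =>
          (measurable_resolvent_block hA hτ hrun (hzm k) (hwm k) i).2).const_mul _)
    have hR1 : IntegrableOn (fun ω => V ω - β₁ * inner ℝ (z k ω - q.1) (e k ω)) s μ :=
      hVint.sub (hX1.const_mul β₁)
    have hR2 : IntegrableOn (fun ω => V ω - β₁ * inner ℝ (z k ω - q.1) (e k ω)
        - β₂ * inner ℝ (B (z k ω) - w k ω (Fin.last n)) (ε k ω)) s μ :=
      hR1.sub (hX2.const_mul β₂)
    have hR3 : IntegrableOn (fun ω => V ω - β₁ * inner ℝ (z k ω - q.1) (e k ω)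
        - β₂ * inner ℝ (B (z k ω) - w k ω (Fin.last n)) (ε k ω) + β₃ * ‖ε k ω‖ ^ 2) s μ :=
      hR2.add (hεI.const_mul β₃)
    have hQ : IntegrableOn (fun ω => V ω + ‖ε k ω‖ ^ 2 + ‖e k ω‖ ^ 2) s μ := hQ1.add heI
    have hRint : IntegrableOn R s μ := hR3.add (hQ.const_mul β₄)
    have hRval : ∫ ω in s, R ω ∂μ = ∫ ω in s, V ω ∂μ + β₃ * ∫ ω in s, ‖ε k ω‖ ^ 2 ∂μ
        + β₄ * (∫ ω in s, V ω ∂μ + ∫ ω in s, ‖ε k ω‖ ^ 2 ∂μ + ∫ ω in s, ‖e k ω‖ ^ 2 ∂μ) := by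
      simp only [hR]
      rw [integral_add hR3 (hQ.const_mul β₄), integral_add hR2 (hεI.const_mul β₃),
        integral_sub hR1 (hX2.const_mul β₂), integral_sub hVint (hX1.const_mul β₁),
        integral_const_mul, integral_const_mul, integral_const_mul, integral_const_mul,
        integral_add hQ1 heI, integral_add hVint hεI, hX1', hX2']
      ring
    have hlhsint : IntegrableOn lhs s μ := by
      refine hRint.mono' hlhsm.aestronglyMeasurable (ae_of_all _ fun ω => ?_)
      rw [Real.norm_of_nonneg (hlhs0 ω)]
      exact hlhsR ω
    set a : ℝ := K * (α k * ρ k ^ 2 + α k ^ 2) with ha_def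
    have hαρ0 : 0 ≤ α k * ρ k ^ 2 := mul_nonneg (hα k) (sq_nonneg _)
    have ha0 : 0 ≤ a := mul_nonneg hK (add_nonneg hαρ0 (sq_nonneg _))
    have hrhs0 : ∀ ω, 0 ≤ (1 + a) * V ω + a := fun ω => by
      have := hV0 ω
      positivity
    have hrhsint : IntegrableOn (fun ω => (1 + a) * V ω + a) s μ :=
      Integrable.add (hVint.const_mul _) (integrable_const _)
    have hrhsval : ∫ ω in s, ((1 + a) * V ω + a) ∂μ = ∫ ω in s, V ω ∂μ + a * J := by
      rw [integral_add (hVint.const_mul _) (integrable_const _), integral_const_mul, hJeq]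
      have : ∫ _ω in s, a ∂μ = a * ∫ _ω in s, (1 : ℝ) ∂μ := by
        rw [← integral_const_mul, mul_one]
      rw [this]
      ring
    have hmain : ∫ ω in s, lhs ω ∂μ ≤ ∫ ω in s, ((1 + a) * V ω + a) ∂μ := by
      refine (integral_mono hlhsint hRint hlhsR).trans ?_
      rw [hRval, hrhsval]
      have hJ0 : 0 ≤ J := by linarith
      have h1 := mul_le_mul_of_nonneg_left hεJ hβ₃
      have h2 : β₄ * (∫ ω in s, V ω ∂μ + ∫ ω in s, ‖ε k ω‖ ^ 2 ∂μ + ∫ ω in s, ‖e k ω‖ ^ 2 ∂μ)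
          ≤ β₄ * (J + D₁ * J + D₂ * J) := by
        gcongr
        linarith
      have h3 : β₃ * (D₁ * J) + β₄ * (J + D₁ * J + D₂ * J) ≤ a * J := by
        have h4 : 0 ≤ 2 * L * D₁ * α k ^ 2 * J := by positivity
        have h5 : 0 ≤ C * (1 + D₁ + D₂) * (α k * ρ k ^ 2) * J := by positivity
        simp only [ha_def, β₃, β₄, K]
        linarith
      linarith
    change ∫⁻ ω in s, ENNReal.ofReal (lhs ω) ∂μ
      ≤ ∫⁻ ω in s, ENNReal.ofReal ((1 + a) * V ω + a) ∂μ
    rw [← ofReal_integral_eq_lintegral_ofReal hlhsint (ae_of_all _ hlhs0),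
      ← ofReal_integral_eq_lintegral_ofReal hrhsint (ae_of_all _ hrhs0)]
    exact ENNReal.ofReal_le_ofReal hmain

end SPS

/-! ### Almost sure convergence -/

theorem theorem1 {d n : ℕ} {Ω : Type*} [MeasurableSpace Ω] (μ : Measure Ω)
    [IsProbabilityMeasure μ]
    (A : Fin n → SPS.Vec d → Set (SPS.Vec d)) (B : SPS.Vec d → SPS.Vec d) (L : ℝ≥0)
    (hA : ∀ i, SPS.IsMaximalMonotone (A i))
    (hBmono : ∀ u v : SPS.Vec d, 0 ≤ inner ℝ (B u - B v) (u - v))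
    (hBlip : LipschitzWith L B)
    (hsol : ∃ z : SPS.Vec d, SPS.IsSolution A B z)
    (τ : ℝ) (hτ : 0 < τ)
    (α ρ : ℕ → ℝ) (hα : ∀ k, 0 ≤ α k) (hρ : ∀ k, 0 ≤ ρ k)
    (hαρ : Tendsto (fun K : ℕ => ∑ k ∈ Finset.range K, α k * ρ k) atTop atTop)
    (hα2 : Summable fun k => α k ^ 2)
    (hαρ2 : Summable fun k => α k * ρ k ^ 2)
    (ρbar : ℝ) (hρbar : ∀ k, ρ k ≤ ρbar) (hρbarL : ρbar * (L : ℝ) < 1)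
    (ε e : ℕ → Ω → SPS.Vec d) (z : ℕ → Ω → SPS.Vec d)
    (w x y : ℕ → Ω → Fin (n + 1) → SPS.Vec d)
    (hz0 : Measurable (z 0)) (hw0 : Measurable (w 0))
    (hεmeas : ∀ k, Measurable (ε k)) (hemeas : ∀ k, Measurable (e k))
    (hrun : ∀ ω, SPS.IsRun A B τ α ρ (fun k => ε k ω) (fun k => e k ω)
      (fun k => z k ω) (fun k => w k ω) (fun k => x k ω) (fun k => y k ω))
    (hεint : ∀ k, Integrable (ε k) μ) (heint : ∀ k, Integrable (e k) μ)
    (hεmean : ∀ k, μ[ε k | SPS.pastSigma z w k] =ᵐ[μ] 0)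
    (hemean : ∀ k, μ[e k | SPS.pastSigma z w k] =ᵐ[μ] 0)
    (N₁ N₂ N₃ N₄ : ℝ) (hN₁ : 0 ≤ N₁) (hN₂ : 0 ≤ N₂) (hN₃ : 0 ≤ N₃) (hN₄ : 0 ≤ N₄)
    (hεvar : ∀ k, ∀ᵐ ω ∂μ,
      condLExp (SPS.pastSigma z w k) μ (fun ω' => ‖ε k ω'‖ₑ ^ 2) ω
        ≤ ENNReal.ofReal (N₁ + N₂ * ‖B (z k ω)‖ ^ 2))
    (hevar : ∀ k, ∀ᵐ ω ∂μ,
      condLExp (SPS.pastSigma z w k ⊔ SPS.noiseSigma (ε k)) μ (fun ω' => ‖e k ω'‖ₑ ^ 2) ω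
        ≤ ENNReal.ofReal (N₃ + N₄ * ‖B (x k ω (Fin.last n))‖ ^ 2)) :
    ∀ᵐ ω ∂μ,
      (∃ zstar : SPS.Vec d, SPS.IsSolution A B zstar ∧
        Tendsto (fun k => z k ω) atTop (𝓝 zstar)) ∧
      (∃ pstar ∈ SPS.extendedSolutionSet A B,
        Tendsto (fun k => (z k ω, w k ω)) atTop (𝓝 pstar)) := by
  obtain ⟨z₀, hz₀⟩ := hsol
  obtain ⟨w₀, hw₀⟩ := SPS.exists_mem_extendedSolutionSet hz₀
  -- The exceptional null set depends on `q`; countably many `q` dense in the extended solution set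
  -- allow one null set for all.
  obtain ⟨D, hDS, hDc, hSD⟩ := (TopologicalSpace.IsSeparable.of_separableSpace
    (SPS.extendedSolutionSet A B)).exists_countable_dense_subset
  have hpoint : ∀ q ∈ SPS.extendedSolutionSet A B, ∀ᵐ ω ∂μ,
      (∃ c, Tendsto (fun k => SPS.sqDist (z k ω, w k ω) q) atTop (𝓝 c)) ∧
        Summable fun k => (α k * ρ k) * SPS.residual B (z k ω) (w k ω) (y k ω) := fun q hq =>
    SPS.ae_tendsto_sqDist_and_summable_residual (fun i => (hA i).1) hBmono hBlip hτ hα hρ hα2 hαρ2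
      hρbar hρbarL hz0 hw0 hεmeas hemeas hrun hεint heint hεmean hemean hN₁ hN₂ hN₃ hN₄ hεvar hevar
      hq
  have hdense := (ae_ball_iff hDc).2 fun q hq => hpoint q (hDS hq)
  -- The residual does not involve `q`, so one known solution provides both the summability and the
  -- boundedness behind the cluster point.
  filter_upwards [hdense, hpoint _ hw₀] with ω hω hω₀
  obtain ⟨⟨l, hl⟩, hsum⟩ := hω₀
  obtain ⟨a, ha, φ, hφ, hlim⟩ := (hrun ω).exists_cluster_point hτ hA hBlip.continuous
    (fun k => mul_nonneg (hα k) (hρ k)) hαρ hsum hl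
  have hconv : Tendsto (fun k => (z k ω, w k ω)) atTop (𝓝 a) :=
    SPS.tendsto_of_tendsto_sqDist hSD (fun q hq => (hω q hq).1) hφ ha hlim
  exact ⟨⟨a.1, SPS.isSolution_of_mem_extendedSolutionSet ha, hconv.fst_nhds⟩, a, ha, hconv⟩
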